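/- For a point $(a,b)\in\mathbb R^2$ with $b>0$ let $K$ be the triangle with vertices $O=(0,0)$, $A=(1,0)$, $B=(a,b)$ and edges $e_1,e_2,e_3$. Let $$V^{\rm FM}(K)=\Big\{u\in H^2(K):\ u(O)=u(A)=u(B)=0,\ \int_{e_i}\frac{\partial u}{\partial n}\,ds=0\ (i=1,2,3)\Big\},$$ $$C_1(K)=\sup\Big\{\frac{\|\nabla u\|_{L^2(K)}}{\|D^2u\|_{L^2(K)}}:\ u\in V^{\rm FM}(K),\ D^2u\ne 0\Big\}\in[0,\infty],$$ where $D^2u=(u_{xx},u_{xy},u_{yx},u_{yy})$, the values of $u$ at the vertices are those of its continuous representative, and $\partial u/\partial n$ on $e_i$ is the normal component of the trace of $\nabla u$. Let $\Omega=\{(a,b)\in\mathbb R^2: a^2+b^2\le 1,\ a\ge \tfrac12,\ b>0\}$. Theorem. Let $(a,b)\in\Omega$ and let $\alpha,\varepsilon\in\mathbb R$ satisfy $|\alpha|,|\varepsilon|\le\tfrac12$ and $(a+\alpha b,(1+\varepsilon)b)\in\Omega$. Let $K$ be the triangle with vertices $(0,0)$, $(1,0)$, $(a,b)$ and $\widetilde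 K$ the triangle with vertices $(0,0)$, $(1,0)$, $(a+\alpha b,(1+\varepsilon)b)$. If $\varepsilon\ge 0$, then $$C_1(\widetilde K)\le\Big(1+\tfrac32|\alpha|+2|\varepsilon|+\tfrac32|\alpha|^2+|\varepsilon|^2\Big)C_1(K),$$ and if $\varepsilon\le 0$, then $$C_1(\widetilde K)\le\Big(1+\tfrac32|\alpha|+|\varepsilon|+\tfrac32|\alpha|^2+2|\varepsilon|^2\Big)C_1(K).$$ -/

import Mathlib

open MeasureTheory Filter Topology Set
open scoped ENNReal ContDiff

noncomputable section

namespace FujinoMorley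

/-- The Euclidean plane. -/
abbrev Plane : Type := EuclideanSpace ℝ (Fin 2)

/-- The partial derivative `∂ᵢ φ` of a smooth function. -/
def partialDeriv (i : Fin 2) (φ : Plane → ℝ) (x : Plane) : ℝ :=
  fderiv ℝ φ x (EuclideanSpace.single i 1)

/-- `g` is the weak partial derivative `∂ᵢ w` in the open set `U`
(used for square integrable `w` and `g`). -/
def HasWeakPartial (U : Set Plane) (i : Fin 2) (w g : Plane → ℝ) : Prop :=
  ∀ φ : Plane → ℝ, ContDiff ℝ ∞ φ → HasCompactSupport φ → tsupport φ ⊆ U →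
    ∫ x in U, w x * partialDeriv i φ x = -∫ x in U, g x * φ x

/-- A function of the Sobolev space `H²(U)`, together with its weak gradient `(uₓ, u_y)` and
its weak second derivatives `D²u = (uₓₓ, uₓ_y, u_yₓ, u_y_y)`; `hess x (i, j)` is `∂ⱼ∂ᵢ u`.
Both are determined by `u` up to a null set. -/
structure H2Function (U : Set Plane) where
  val : Plane → ℝ
  grad : Plane → EuclideanSpace ℝ (Fin 2)
  hess : Plane → EuclideanSpace ℝ (Fin 2 × Fin 2)
  memLp_val : MemLp val 2 (volume.restrict U)
  memLp_grad : MemLp grad 2 (volume.restrict U)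
  memLp_hess : MemLp hess 2 (volume.restrict U)
  weak_grad : ∀ i, HasWeakPartial U i val (fun x => grad x i)
  weak_hess : ∀ i j, HasWeakPartial U j (fun x => grad x i) (fun x => hess x (i, j))

/-- The seminorm `‖∇u‖_U`, the `L²(U)` norm of the Euclidean length of `∇u`. -/
def H2Function.gradNorm {U : Set Plane} (u : H2Function U) : ℝ≥0∞ :=
  eLpNorm u.grad 2 (volume.restrict U)

/-- The seminorm `‖D²u‖_U`, the `L²(U)` norm of the Euclidean (Frobenius) length of `D²u`. -/
def H2Function.hessNorm {U : Set Plane} (u : H2Function U) : ℝ≥0∞ :=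
  eLpNorm u.hess 2 (volume.restrict U)

/-- The arc length measure of the segment from `p` to `q`. -/
def segmentMeasure (p q : Plane) : Measure Plane :=
  (ENNReal.ofReal (dist p q) • (volume.restrict (Icc (0 : ℝ) 1))).map
    (AffineMap.lineMap p q : ℝ → Plane)

/-- The unit normal vector of the segment from `p` to `q` (for `p ≠ q`). -/
def unitNormal (p q : Plane) : Plane :=
  (dist p q)⁻¹ • !₂[q 1 - p 1, p 0 - q 0]

/-- `T` is the trace on the segment from `p` to `q` of the function `w ∈ H¹(U)` with weak gradient
`g`. The trace operator is the continuous extension to `H¹(U)` of the restriction of smooth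
functions: there are smooth functions on the plane that converge to `w` in `H¹(U)`, and whose
restrictions to the segment converge to `T` in `L²`. -/
def HasTrace (U : Set Plane) (p q : Plane) (w : Plane → ℝ) (g : Fin 2 → Plane → ℝ)
    (T : Plane → ℝ) : Prop :=
  MemLp T 2 (segmentMeasure p q) ∧
  ∃ φ : ℕ → Plane → ℝ, (∀ k, ContDiff ℝ ∞ (φ k)) ∧
    Tendsto (fun k => eLpNorm (fun x => φ k x - w x) 2 (volume.restrict U)) atTop (𝓝 0) ∧
    (∀ i, Tendsto (fun k => eLpNorm (fun x => partialDeriv i (φ k) x - g i x) 2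
      (volume.restrict U)) atTop (𝓝 0)) ∧
    Tendsto (fun k => eLpNorm (fun x => φ k x - T x) 2 (segmentMeasure p q)) atTop (𝓝 0)

/-- `∫ₑ ∂u/∂n ds = 0` on the segment `e` from `p` to `q`, where `∂u/∂n = T · n` for the trace `T`
of the gradient of `u ∈ H²(U)`. -/
def H2Function.NormalIntegralZero {U : Set Plane} (u : H2Function U) (p q : Plane) : Prop :=
  ∃ T : Plane → Plane,
    (∀ i, HasTrace U p q (fun x => u.grad x i) (fun j x => u.hess x (i, j)) (fun x => T x i)) ∧
    ∫ x, inner ℝ (T x) (unitNormal p q) ∂(segmentMeasure p q) = 0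

/-- The closed triangle with vertices `P 0`, `P 1`, `P 2`. -/
def triangle (P : Fin 3 → Plane) : Set Plane := convexHull ℝ (range P)

/-- The kernel space `V^FM(K)` of the Fujino--Morley interpolation on the triangle `K` with
vertices `P 0`, `P 1`, `P 2`. A class in `H²(K)` has a representative that is continuous on the
closed triangle; it is the one meant by the values at the vertices. -/
def VFM (P : Fin 3 → Plane) : Set (H2Function (interior (triangle P))) :=
  {u | ContinuousOn u.val (triangle P) ∧ (∀ i, u.val (P i) = 0) ∧
    ∀ i, u.NormalIntegralZero (P i) (P (i + 1))}

/-- The constant `C₁(K) = sup {‖∇u‖_K / ‖D²u‖_K : u ∈ V^FM(K), D²u ≠ 0}`, a supremum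
in `[0, ∞]`. -/
def C₁ (P : Fin 3 → Plane) : ℝ≥0∞ :=
  ⨆ u ∈ {u | u ∈ VFM P ∧ u.hessNorm ≠ 0}, u.gradNorm / u.hessNorm

/-- The triple of vertices `O = (0,0)`, `A = (1,0)`, `B = (a,b)`. -/
def vertices (a b : ℝ) : Fin 3 → Plane := ![!₂[0, 0], !₂[1, 0], !₂[a, b]]

/-- The region `Ω` of the third vertex. -/
def Ω : Set (ℝ × ℝ) := {p | p.1 ^ 2 + p.2 ^ 2 ≤ 1 ∧ 1 / 2 ≤ p.1 ∧ 0 < p.2}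

end FujinoMorley

end

noncomputable section

namespace FujinoMorley

/-! The affine map `f` fixing `O` and `A` and sending `B` to the new vertex has linear part with
columns `(1, 0)` and `(α, d)`, `d = 1 + ε`. A competitor `u` on the new triangle is compared with `v
= u ∘ f` on the old one. If `s` bounds the largest singular value of the linear part, then `d / s`
bounds the smallest one from below, since their product is the determinant `d`. Hence pointwise
`|∇u| ∘ f ≤ (s / d) |∇v|` and `|D²v| ≤ s² |D²u| ∘ f`. The Jacobian cancels in the quotient, and the
constants differ by at most the factor `s³ / d` (`C₁_le_of_affine`, `C₁_vertices_le`).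

For this `v` has to lie in the kernel space again, although affine maps do not preserve normals
(`pullback_mem_VFM`). The point is that zero vertex values make the tangential derivative have mean
zero on each edge. Together with the normal condition the whole gradient has mean zero there, and
this property is affine invariant. For `H²` functions with traces defined by approximation, the
tangential statement is a fundamental theorem of calculus along an edge. It is proved on the
reference triangle (`HasTrace.integral_eq_sub_of_continuous`) by testing with cutoffs concentrated
near the edge, and carried to other edges by affine maps.

It remains to choose an explicit `s`, quadratic in `|α|`, that dominates the largest singular value
and satisfies `s³ ≤ d` times the claimed polynomial. These are the four scalar inequalities
`contraction_factor_lower`, `contraction_factor_upper`, `expansion_factor_lower`,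
`expansion_factor_upper`. -/

/-! ### Measures under affine changes of variables -/

/-- The affine homeomorphism `x ↦ L x + c` of the plane. -/
def affineHomeo (L : Plane ≃L[ℝ] Plane) (c : Plane) : Plane ≃ₜ Plane :=
  L.toHomeomorph.trans (Homeomorph.addRight c)

@[simp] theorem affineHomeo_apply (L : Plane ≃L[ℝ] Plane) (c x : Plane) :
    affineHomeo L c x = L x + c := rfl

/-- `ν` is a positive multiple of the image of `μ` under the homeomorphism `f`. -/
def IsScaledImage (f : Plane ≃ₜ Plane) (μ ν : Measure Plane) : Prop :=
  ∃ k : ℝ≥0∞, k ≠ 0 ∧ k ≠ ⊤ ∧ ν = k • μ.map f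

/-- The factor `k` is the same for all `F` and all target spaces, so it cancels in the quotient of
the gradient and Hessian norms. -/
theorem IsScaledImage.exists_eLpNorm {f : Plane ≃ₜ Plane} {μ ν : Measure Plane}
    (h : IsScaledImage f μ ν) :
    ∃ k : ℝ≥0∞, k ≠ 0 ∧ k ≠ ⊤ ∧ ∀ (E : Type) [NormedAddCommGroup E] (F : Plane → E),
      eLpNorm F 2 ν = k * eLpNorm (F ∘ f) 2 μ := by
  obtain ⟨k, h0, ht, rfl⟩ := h
  refine ⟨k ^ (1 / (2 : ℝ≥0∞)).toReal, ?_, ?_, fun E _ F => ?_⟩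
  · simp [h0, ht]
  · simp [h0, ht]
  · rw [eLpNorm_smul_measure_of_ne_zero h0, f.measurableEmbedding.eLpNorm_map_measure, smul_eq_mul]

theorem IsScaledImage.memLp_comp {f : Plane ≃ₜ Plane} {μ ν : Measure Plane}
    (h : IsScaledImage f μ ν) {E : Type} [NormedAddCommGroup E] {F : Plane → E}
    (hF : MemLp F 2 ν) : MemLp (fun x => F (f x)) 2 μ := by
  change MemLp (F ∘ f) 2 μ
  obtain ⟨k, h0, ht, rfl⟩ := h
  rw [← f.measurableEmbedding.memLp_map_measure_iff]
  have : μ.map f = k⁻¹ • (k • μ.map f) := by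
    rw [smul_smul, ENNReal.inv_mul_cancel h0 ht, one_smul]
  rw [this]
  exact hF.smul_measure (ENNReal.inv_ne_top.2 h0)

theorem IsScaledImage.tendsto_eLpNorm_comp {f : Plane ≃ₜ Plane} {μ ν : Measure Plane}
    (h : IsScaledImage f μ ν) {F : ℕ → Plane → ℝ}
    (hF : Tendsto (fun k => eLpNorm (F k) 2 ν) atTop (𝓝 0)) :
    Tendsto (fun k => eLpNorm (fun x => F k (f x)) 2 μ) atTop (𝓝 0) := by
  change Tendsto (fun k => eLpNorm (F k ∘ f) 2 μ) atTop (𝓝 0)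
  obtain ⟨c, h0, ht, hc⟩ := h.exists_eLpNorm
  have h1 : ∀ k, eLpNorm (F k ∘ f) 2 μ = c⁻¹ * eLpNorm (F k) 2 ν := fun k => by
    rw [hc, ← mul_assoc, ENNReal.inv_mul_cancel h0 ht, one_mul]
  simp_rw [h1]
  simpa using ENNReal.Tendsto.const_mul hF (Or.inr (ENNReal.inv_ne_top.2 h0))

theorem IsScaledImage.exists_integral {f : Plane ≃ₜ Plane} {μ ν : Measure Plane}
    (h : IsScaledImage f μ ν) :
    ∃ k : ℝ, k ≠ 0 ∧ ∀ F : Plane → ℝ, ∫ x, F (f x) ∂μ = k * ∫ y, F y ∂ν := by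
  obtain ⟨k, h0, ht, rfl⟩ := h
  have hk : k.toReal ≠ 0 := ENNReal.toReal_ne_zero.2 ⟨h0, ht⟩
  refine ⟨k.toReal⁻¹, inv_ne_zero hk, fun F => ?_⟩
  rw [integral_smul_measure, f.measurableEmbedding.integral_map, smul_eq_mul, ← mul_assoc,
    inv_mul_cancel₀ hk, one_mul]

theorem isScaledImage_volume (L : Plane ≃L[ℝ] Plane) (c : Plane) :
    IsScaledImage (affineHomeo L c) volume volume := by
  have hd : LinearMap.det (L.toLinearEquiv : Plane →ₗ[ℝ] Plane) ≠ 0 :=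
    (LinearEquiv.isUnit_det' L.toLinearEquiv).ne_zero
  have h := Measure.map_linearMap_addHaar_eq_smul_addHaar (volume : Measure Plane) hd
  set d := LinearMap.det (L.toLinearEquiv : Plane →ₗ[ℝ] Plane)
  have h1 : (volume : Measure Plane).map (affineHomeo L c) = ENNReal.ofReal |d⁻¹| • volume := by
    have : (affineHomeo L c : Plane → Plane) = (fun x => x + c) ∘ L := rfl
    rw [this, ← Measure.map_map (by fun_prop) (by fun_prop)]
    have h2 : (volume : Measure Plane).map L = ENNReal.ofReal |d⁻¹| • volume := h
    rw [h2, Measure.map_smul, map_add_right_eq_self]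
  have h0 : ENNReal.ofReal |d⁻¹| ≠ 0 := by simpa using hd
  refine ⟨(ENNReal.ofReal |d⁻¹|)⁻¹, by simp, ENNReal.inv_ne_top.2 h0, ?_⟩
  rw [h1, smul_smul, ENNReal.inv_mul_cancel h0 (by simp), one_smul]

theorem IsScaledImage.restrict {f : Plane ≃ₜ Plane} {μ ν : Measure Plane}
    (h : IsScaledImage f μ ν) (V : Set Plane) :
    IsScaledImage f (μ.restrict (f ⁻¹' V)) (ν.restrict V) := by
  obtain ⟨k, h0, ht, rfl⟩ := h
  exact ⟨k, h0, ht, by rw [Measure.restrict_smul, f.measurableEmbedding.restrict_map]⟩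

theorem isScaledImage_volume_restrict (L : Plane ≃L[ℝ] Plane) (c : Plane) (V : Set Plane) :
    IsScaledImage (affineHomeo L c) (volume.restrict (affineHomeo L c ⁻¹' V))
      (volume.restrict V) :=
  (isScaledImage_volume L c).restrict V

theorem affineHomeo_lineMap (L : Plane ≃L[ℝ] Plane) (c p q : Plane) (t : ℝ) :
    affineHomeo L c (AffineMap.lineMap p q t) =
      AffineMap.lineMap (affineHomeo L c p) (affineHomeo L c q) t := by
  simp only [affineHomeo_apply, AffineMap.lineMap_apply_module, map_add, map_smul]
  module

theorem isScaledImage_segmentMeasure (L : Plane ≃L[ℝ] Plane) (c : Plane) {p q : Plane}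
    (hpq : p ≠ q) :
    IsScaledImage (affineHomeo L c) (segmentMeasure p q)
      (segmentMeasure (affineHomeo L c p) (affineHomeo L c q)) := by
  set f := affineHomeo L c
  have hd : 0 < dist p q := dist_pos.2 hpq
  have hd' : 0 < dist (f p) (f q) := dist_pos.2 (f.injective.ne hpq)
  refine ⟨ENNReal.ofReal (dist (f p) (f q) / dist p q), ?_, by simp, ?_⟩
  · simpa using div_pos hd' hd
  · have h1 : (AffineMap.lineMap (f p) (f q) : ℝ → Plane) = f ∘ (AffineMap.lineMap p q) :=
      funext fun t => (affineHomeo_lineMap L c p q t).symm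
    have hm : Measurable (AffineMap.lineMap p q : ℝ → Plane) :=
      AffineMap.lineMap_continuous.measurable
    rw [segmentMeasure, segmentMeasure, h1, ← Measure.map_map f.measurable hm, Measure.map_smul,
      Measure.map_smul, Measure.map_smul, Measure.map_smul, smul_smul,
      ← ENNReal.ofReal_mul (by positivity), div_mul_cancel₀ _ hd.ne']

/-! ### Chain rule for weak derivatives, traces and `H²` functions -/

/-- The components of the linear map: `coeff L i j` is the `j`-th coordinate of `L eᵢ`. -/
def coeff (L : Plane ≃L[ℝ] Plane) (i j : Fin 2) : ℝ := L (EuclideanSpace.single i 1) j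

theorem partialDeriv_comp_affineHomeo (L : Plane ≃L[ℝ] Plane) (c : Plane) {ψ : Plane → ℝ}
    (hψ : ContDiff ℝ ∞ ψ) (i : Fin 2) (x : Plane) :
    partialDeriv i (fun x => ψ (affineHomeo L c x)) x =
      ∑ j, coeff L i j * partialDeriv j ψ (affineHomeo L c x) := by
  have h1 : HasFDerivAt (fun x => affineHomeo L c x) (L : Plane →L[ℝ] Plane) x :=
    L.hasFDerivAt.add_const c
  have h2 : HasFDerivAt ψ (fderiv ℝ ψ (affineHomeo L c x)) (affineHomeo L c x) :=
    (hψ.differentiable (by simp)).differentiableAt.hasFDerivAt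
  have h3 : HasFDerivAt (fun x => ψ (affineHomeo L c x)) _ x := h2.comp x h1
  rw [partialDeriv, h3.fderiv]
  have h4 : L (EuclideanSpace.single i 1) = ∑ j, coeff L i j • EuclideanSpace.single j (1:ℝ) := by
    ext k
    fin_cases k <;> simp [coeff]
  simp only [ContinuousLinearMap.comp_apply, ContinuousLinearEquiv.coe_coe, h4, map_sum, map_smul,
    smul_eq_mul, partialDeriv]

theorem contDiff_affineHomeo (L : Plane ≃L[ℝ] Plane) (c : Plane) :
    ContDiff ℝ ∞ (affineHomeo L c) :=
  L.contDiff.add contDiff_const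

theorem contDiff_affineHomeo_symm (L : Plane ≃L[ℝ] Plane) (c : Plane) :
    ContDiff ℝ ∞ (affineHomeo L c).symm := by
  have : ((affineHomeo L c).symm : Plane → Plane) = fun y => L.symm (y - c) := by
    funext y
    rw [Homeomorph.symm_apply_eq]
    simp
  rw [this]
  exact L.symm.contDiff.comp (contDiff_id.sub contDiff_const)

theorem continuous_partialDeriv {φ : Plane → ℝ} (hφ : ContDiff ℝ ∞ φ) (i : Fin 2) :
    Continuous (partialDeriv i φ) :=
  (hφ.continuous_fderiv (by simp)).clm_apply continuous_const

theorem hasCompactSupport_partialDeriv {φ : Plane → ℝ} (hφ : HasCompactSupport φ) (i : Fin 2) :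
    HasCompactSupport (partialDeriv i φ) :=
  hφ.fderiv_apply (𝕜 := ℝ) _

theorem integrable_mul_of_memLp {μ : Measure Plane} [IsFiniteMeasureOnCompacts μ] {w φ : Plane → ℝ}
    (hw : MemLp w 2 μ) (hφ : Continuous φ) (hc : HasCompactSupport φ) :
    Integrable (fun x => w x * φ x) μ :=
  hw.integrable_mul (hφ.memLp_of_hasCompactSupport hc : MemLp φ 2 μ)

/-- Transport the test function instead: `ψ = φ ∘ f⁻¹` is admissible on `V`, the classical chain
rule applies to `φ = ψ ∘ f`, and the change of variables multiplies both sides by the same constant.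
-/
theorem HasWeakPartial.comp_affineHomeo (L : Plane ≃L[ℝ] Plane) (c : Plane) {V : Set Plane}
    {w : Plane → ℝ} {g : Fin 2 → Plane → ℝ} (hw : MemLp w 2 (volume.restrict V))
    (hg : ∀ j, MemLp (g j) 2 (volume.restrict V)) (h : ∀ j, HasWeakPartial V j w (g j))
    (i : Fin 2) :
    HasWeakPartial (affineHomeo L c ⁻¹' V) i (fun x => w (affineHomeo L c x))
      (fun x => ∑ j, coeff L i j * g j (affineHomeo L c x)) := by
  intro φ hφ hcs hsupp
  set f := affineHomeo L c with hf
  obtain ⟨k, -, hk⟩ := (isScaledImage_volume_restrict L c V).exists_integral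
  set ψ : Plane → ℝ := φ ∘ f.symm with hψd
  have hψ : ContDiff ℝ ∞ ψ := hφ.comp (contDiff_affineHomeo_symm L c)
  have hψc : HasCompactSupport ψ := hcs.comp_homeomorph f.symm
  have hψs : tsupport ψ ⊆ V := by
    intro y hy
    have : f.symm y ∈ tsupport φ := by
      have h1 := tsupport_comp_eq_preimage φ f.symm
      rw [← hψd] at h1
      rw [h1] at hy
      exact hy
    simpa using hsupp this
  have hφψ : φ = fun x => ψ (f x) := by funext x; simp [hψd]
  have hI : ∀ j, Integrable (fun y => w y * partialDeriv j ψ y) (volume.restrict V) := fun j =>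
    integrable_mul_of_memLp hw (continuous_partialDeriv hψ j)
      (hasCompactSupport_partialDeriv hψc j)
  have hJ : ∀ j, Integrable (fun y => g j y * ψ y) (volume.restrict V) := fun j =>
    integrable_mul_of_memLp (hg j) hψ.continuous hψc
  have e1 : ∀ x, w (f x) * partialDeriv i φ x =
      (fun y => ∑ j, coeff L i j * (w y * partialDeriv j ψ y)) (f x) := fun x => by
    rw [hφψ, partialDeriv_comp_affineHomeo L c hψ, Finset.mul_sum]
    exact Finset.sum_congr rfl fun j _ => by ring
  have e2 : ∀ x, (∑ j, coeff L i j * g j (f x)) * φ x =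
      (fun y => ∑ j, coeff L i j * (g j y * ψ y)) (f x) := fun x => by
    rw [hφψ, Finset.sum_mul]
    exact Finset.sum_congr rfl fun j _ => by ring
  rw [(integral_congr_ae (ae_of_all _ e1)).trans
      (hk fun y => ∑ j, coeff L i j * (w y * partialDeriv j ψ y)),
    (integral_congr_ae (ae_of_all _ e2)).trans (hk fun y => ∑ j, coeff L i j * (g j y * ψ y)),
    integral_finsetSum _ fun j _ => (hI j).const_mul _,
    integral_finsetSum _ fun j _ => (hJ j).const_mul _, ← mul_neg, ← Finset.sum_neg_distrib]
  congr 1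
  refine Finset.sum_congr rfl fun j _ => ?_
  rw [integral_const_mul, integral_const_mul, h j ψ hψ hψc hψs, mul_neg]

/-- Needed for second derivatives: each component of the pulled-back gradient is a
constant-coefficient combination of composed components. -/
theorem HasWeakPartial.sum_const_mul {U : Set Plane} {j : Fin 2} {w g : Fin 2 → Plane → ℝ}
    (a : Fin 2 → ℝ) (hw : ∀ k, MemLp (w k) 2 (volume.restrict U))
    (hg : ∀ k, MemLp (g k) 2 (volume.restrict U)) (h : ∀ k, HasWeakPartial U j (w k) (g k)) :
    HasWeakPartial U j (fun x => ∑ k, a k * w k x) (fun x => ∑ k, a k * g k x) := by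
  intro φ hφ hcs hsupp
  have hI : ∀ k, Integrable (fun y => w k y * partialDeriv j φ y) (volume.restrict U) := fun k =>
    integrable_mul_of_memLp (hw k) (continuous_partialDeriv hφ j)
      (hasCompactSupport_partialDeriv hcs j)
  have hJ : ∀ k, Integrable (fun y => g k y * φ y) (volume.restrict U) := fun k =>
    integrable_mul_of_memLp (hg k) hφ.continuous hcs
  simp_rw [Finset.sum_mul, mul_assoc]
  rw [integral_finsetSum _ fun k _ => (hI k).const_mul _,
    integral_finsetSum _ fun k _ => (hJ k).const_mul _, ← Finset.sum_neg_distrib]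
  refine Finset.sum_congr rfl fun k _ => ?_
  rw [integral_const_mul, integral_const_mul, h k φ hφ hcs hsupp, mul_neg]

theorem memLp_plane_apply {ι : Type} [Fintype ι] {μ : Measure Plane}
    {g : Plane → EuclideanSpace ℝ ι} (hg : MemLp g 2 μ) (i : ι) : MemLp (fun x => g x i) 2 μ :=
  (EuclideanSpace.proj i : EuclideanSpace ℝ ι →L[ℝ] ℝ).comp_memLp' hg

theorem memLp_toLp {ι : Type} [Fintype ι] {μ : Measure Plane} {g : ι → Plane → ℝ}
    (hg : ∀ i, MemLp (g i) 2 μ) :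
    MemLp (fun x => (WithLp.toLp 2 fun i => g i x : EuclideanSpace ℝ ι)) 2 μ := by
  have h1 : MemLp (fun x i => g i x) 2 μ := memLp_pi_iff.2 hg
  exact ((PiLp.continuousLinearEquiv 2 ℝ (fun _ : ι => ℝ)).symm :
    (ι → ℝ) →L[ℝ] EuclideanSpace ℝ ι).comp_memLp' h1

theorem memLp_sum_const_mul {μ : Measure Plane} {w : Fin 2 → Plane → ℝ} (a : Fin 2 → ℝ)
    (hw : ∀ k, MemLp (w k) 2 μ) : MemLp (fun x => ∑ k, a k * w k x) 2 μ :=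
  memLp_finsetSum _ fun k _ => (hw k).const_mul (a k)

theorem tendsto_eLpNorm_sum_const_mul {μ : Measure Plane} {F : Fin 2 → ℕ → Plane → ℝ}
    (a : Fin 2 → ℝ) (hm : ∀ k n, AEStronglyMeasurable (F k n) μ)
    (hF : ∀ k, Tendsto (fun n => eLpNorm (F k n) 2 μ) atTop (𝓝 0)) :
    Tendsto (fun n => eLpNorm (fun x => ∑ k, a k * F k n x) 2 μ) atTop (𝓝 0) := by
  have h1 : Tendsto (fun n => ∑ k, ‖a k‖ₑ * eLpNorm (F k n) 2 μ) atTop (𝓝 0) := by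
    have : Tendsto (fun n => ∑ k, ‖a k‖ₑ * eLpNorm (F k n) 2 μ) atTop
        (𝓝 (∑ k, ‖a k‖ₑ * 0)) :=
      tendsto_finsetSum _ fun k _ => ENNReal.Tendsto.const_mul (hF k) (Or.inr enorm_ne_top)
    simpa using this
  refine tendsto_of_tendsto_of_tendsto_of_le_of_le tendsto_const_nhds h1 (fun _ => zero_le)
    fun n => ?_
  have h2 : (fun x => ∑ k, a k * F k n x) = ∑ k, a k • F k n := by
    funext x; simp
  rw [h2]
  refine (eLpNorm_sum_le (fun k _ => (hm k n).const_smul (a k)) (by norm_num)).trans ?_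
  exact Finset.sum_le_sum fun k _ => (eLpNorm_const_smul _ _ _ _).le

/-- Composing the smooth approximations with the affine map gives approximations of the composed
function, since all `L²` distances involved change only by constant factors and finite linear
combinations. -/
theorem HasTrace.comp_affineHomeo (L : Plane ≃L[ℝ] Plane) (c : Plane) {V : Set Plane}
    {p q : Plane} (hpq : p ≠ q) {w : Plane → ℝ} {g : Fin 2 → Plane → ℝ} {T : Plane → ℝ}
    (hg : ∀ j, MemLp (g j) 2 (volume.restrict V))
    (h : HasTrace V (affineHomeo L c p) (affineHomeo L c q) w g T) :
    HasTrace (affineHomeo L c ⁻¹' V) p q (fun x => w (affineHomeo L c x))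
      (fun i x => ∑ j, coeff L i j * g j (affineHomeo L c x))
      (fun x => T (affineHomeo L c x)) := by
  obtain ⟨hT, φ, hφ, h1, h2, h3⟩ := h
  have hV := isScaledImage_volume_restrict L c V
  have hs := isScaledImage_segmentMeasure L c hpq
  have e1 := hs.memLp_comp hT
  have e2 := hV.tendsto_eLpNorm_comp h1
  have e3 := hs.tendsto_eLpNorm_comp h3
  have h4 : ∀ j n, AEStronglyMeasurable
      (fun x => partialDeriv j (φ n) (affineHomeo L c x) - g j (affineHomeo L c x))
      (volume.restrict (affineHomeo L c ⁻¹' V)) := fun j n => by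
    have m1 : Continuous fun x => partialDeriv j (φ n) (affineHomeo L c x) :=
      (continuous_partialDeriv (hφ n) j).comp (affineHomeo L c).continuous
    have m2 := (hV.memLp_comp (hg j)).1
    exact m1.aestronglyMeasurable.sub m2
  have h6 := fun j => hV.tendsto_eLpNorm_comp (h2 j)
  refine ⟨e1, fun k x => φ k (affineHomeo L c x),
    fun k => (hφ k).comp (contDiff_affineHomeo L c), e2, fun i => ?_, e3⟩
  have h5 := tendsto_eLpNorm_sum_const_mul (coeff L i) h4 h6
  have e : ∀ n x, ∑ j, coeff L i j *
      (partialDeriv j (φ n) (affineHomeo L c x) - g j (affineHomeo L c x)) =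
      partialDeriv i (fun x => φ n (affineHomeo L c x)) x -
        ∑ j, coeff L i j * g j (affineHomeo L c x) := fun n x => by
    rw [partialDeriv_comp_affineHomeo L c (hφ n), ← Finset.sum_sub_distrib]
    exact Finset.sum_congr rfl fun j _ => mul_sub _ _ _
  simpa only [e] using h5

theorem partialDeriv_sum_const_mul (a : Fin 2 → ℝ) {φ : Fin 2 → Plane → ℝ}
    (hφ : ∀ k, ContDiff ℝ ∞ (φ k)) (i : Fin 2) (x : Plane) :
    partialDeriv i (fun x => ∑ k, a k * φ k x) x = ∑ k, a k * partialDeriv i (φ k) x := by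
  have h : HasFDerivAt (fun x => ∑ k, a k * φ k x) (∑ k, a k • fderiv ℝ (φ k) x) x :=
    HasFDerivAt.fun_sum fun k _ =>
      (((hφ k).differentiable (by simp)).differentiableAt.hasFDerivAt).const_mul (a k)
  rw [partialDeriv, h.fderiv]
  simp [partialDeriv]

theorem HasTrace.sum_const_mul {U : Set Plane} {p q : Plane} {w : Fin 2 → Plane → ℝ}
    {g : Fin 2 → Fin 2 → Plane → ℝ} {T : Fin 2 → Plane → ℝ} (a : Fin 2 → ℝ)
    (hw : ∀ k, MemLp (w k) 2 (volume.restrict U))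
    (hg : ∀ k j, MemLp (g k j) 2 (volume.restrict U))
    (h : ∀ k, HasTrace U p q (w k) (g k) (T k)) :
    HasTrace U p q (fun x => ∑ k, a k * w k x) (fun j x => ∑ k, a k * g k j x)
      (fun x => ∑ k, a k * T k x) := by
  choose hT φ hφ h1 h2 h3 using h
  refine ⟨memLp_finsetSum _ fun k _ => (hT k).const_mul (a k), fun n x => ∑ k, a k * φ k n x,
    fun n => ContDiff.sum fun k _ => contDiff_const.mul (hφ k n), ?_, fun i => ?_, ?_⟩
  · refine (tendsto_eLpNorm_sum_const_mul a
      (fun k n => (hφ k n).continuous.aestronglyMeasurable.sub (hw k).1) h1).congr fun n => ?_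
    simp only [Pi.sub_apply, mul_sub, Finset.sum_sub_distrib]
  · refine (tendsto_eLpNorm_sum_const_mul a
      (fun k n => (continuous_partialDeriv (hφ k n) i).aestronglyMeasurable.sub (hg k i).1)
      fun k => h2 k i).congr fun n => ?_
    simp only [Pi.sub_apply, mul_sub, Finset.sum_sub_distrib,
      partialDeriv_sum_const_mul a fun k => hφ k n]
  · refine (tendsto_eLpNorm_sum_const_mul a
      (fun k n => (hφ k n).continuous.aestronglyMeasurable.sub (hT k).1) h3).congr fun n => ?_
    simp only [Pi.sub_apply, mul_sub, Finset.sum_sub_distrib]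

/-- The function `u ∘ f` for `u ∈ H²(V)` and an affine homeomorphism `f` with `U = f⁻¹(V)`. -/
def H2Function.pullback (L : Plane ≃L[ℝ] Plane) (c : Plane) {U V : Set Plane}
    (hU : U = affineHomeo L c ⁻¹' V) (u : H2Function V) : H2Function U where
  val x := u.val (affineHomeo L c x)
  grad x := WithLp.toLp 2 fun i => ∑ j, coeff L i j * u.grad (affineHomeo L c x) j
  hess x := WithLp.toLp 2 fun p =>
    ∑ k, coeff L p.1 k * ∑ l, coeff L p.2 l * u.hess (affineHomeo L c x) (k, l)
  memLp_val := hU ▸ (isScaledImage_volume_restrict L c V).memLp_comp u.memLp_val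
  memLp_grad := by
    subst hU
    have h := memLp_plane_apply ((isScaledImage_volume_restrict L c V).memLp_comp u.memLp_grad)
    exact memLp_toLp fun i => memLp_sum_const_mul (coeff L i) h
  memLp_hess := by
    subst hU
    have h := memLp_plane_apply ((isScaledImage_volume_restrict L c V).memLp_comp u.memLp_hess)
    exact memLp_toLp fun p => memLp_sum_const_mul (coeff L p.1) fun k =>
      memLp_sum_const_mul (coeff L p.2) fun l => h (k, l)
  weak_grad i := by
    subst hU
    exact HasWeakPartial.comp_affineHomeo L c u.memLp_val (memLp_plane_apply u.memLp_grad)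
      u.weak_grad i
  weak_hess i j := by
    subst hU
    have hV := isScaledImage_volume_restrict L c V
    have hg := memLp_plane_apply (hV.memLp_comp u.memLp_grad)
    have hh := memLp_plane_apply (hV.memLp_comp u.memLp_hess)
    have hw : ∀ k, HasWeakPartial (affineHomeo L c ⁻¹' V) j
        (fun x => u.grad (affineHomeo L c x) k)
        (fun x => ∑ l, coeff L j l * u.hess (affineHomeo L c x) (k, l)) := fun k =>
      HasWeakPartial.comp_affineHomeo L c (memLp_plane_apply u.memLp_grad k)
        (fun l => memLp_plane_apply u.memLp_hess (k, l)) (u.weak_hess k) j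
    exact HasWeakPartial.sum_const_mul (coeff L i) hg
      (fun k => memLp_sum_const_mul (coeff L j) fun l => hh (k, l)) hw

theorem hasTrace_pullback_grad (L : Plane ≃L[ℝ] Plane) (c : Plane) {U V : Set Plane}
    (hU : U = affineHomeo L c ⁻¹' V) (u : H2Function V) {p q : Plane} (hpq : p ≠ q)
    {T : Plane → Plane}
    (hT : ∀ i, HasTrace V (affineHomeo L c p) (affineHomeo L c q) (fun x => u.grad x i)
      (fun j x => u.hess x (i, j)) (fun x => T x i)) (i : Fin 2) :
    HasTrace U p q (fun x => (u.pullback L c hU).grad x i)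
      (fun j x => (u.pullback L c hU).hess x (i, j))
      (fun x => ∑ j, coeff L i j * T (affineHomeo L c x) j) := by
  subst hU
  have hV := isScaledImage_volume_restrict L c V
  have hg := memLp_plane_apply (hV.memLp_comp u.memLp_grad)
  have hh := memLp_plane_apply (hV.memLp_comp u.memLp_hess)
  have hg' := fun k j => memLp_sum_const_mul (coeff L j) fun l => hh (k, l)
  have ht : ∀ k, HasTrace (affineHomeo L c ⁻¹' V) p q (fun x => u.grad (affineHomeo L c x) k)
      (fun j x => ∑ l, coeff L j l * u.hess (affineHomeo L c x) (k, l))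
      (fun x => T (affineHomeo L c x) k) := fun k =>
    (hT k).comp_affineHomeo L c hpq (fun l => memLp_plane_apply u.memLp_hess (k, l))
  have h := HasTrace.sum_const_mul (coeff L i) hg hg' ht
  exact h

theorem preimage_triangle (L : Plane ≃L[ℝ] Plane) (c : Plane) {P Q : Fin 3 → Plane}
    (h : ∀ i, affineHomeo L c (P i) = Q i) :
    triangle P = affineHomeo L c ⁻¹' triangle Q := by
  set A : Plane →ᵃ[ℝ] Plane :=
    (L.toLinearEquiv : Plane →ₗ[ℝ] Plane).toAffineMap + AffineMap.const ℝ Plane c with hA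
  have hAf : (A : Plane → Plane) = affineHomeo L c := by
    funext x
    simp [hA]
  have h1 : affineHomeo L c '' triangle P = triangle Q := by
    rw [triangle, ← hAf, A.image_convexHull, ← range_comp, triangle]
    congr 2
    funext i
    simp [hAf, ← h i]
  rw [← h1, preimage_image_eq _ (affineHomeo L c).injective]

theorem preimage_interior_triangle (L : Plane ≃L[ℝ] Plane) (c : Plane) {P Q : Fin 3 → Plane}
    (h : ∀ i, affineHomeo L c (P i) = Q i) :
    interior (triangle P) = affineHomeo L c ⁻¹' interior (triangle Q) := by
  rw [Homeomorph.preimage_interior, preimage_triangle L c h]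

/-- The linear automorphism of the plane with linearly independent columns `v` and `w`. -/
def columnEquiv (v w : Plane) (h : v 0 * w 1 - v 1 * w 0 ≠ 0) : Plane ≃L[ℝ] Plane :=
  LinearEquiv.toContinuousLinearEquiv
    { toFun := fun x => x 0 • v + x 1 • w
      map_add' := fun x y => by simp only [PiLp.add_apply]; module
      map_smul' := fun r x => by
        simp only [PiLp.smul_apply, smul_eq_mul, RingHom.id_apply]; module
      invFun := fun y => (v 0 * w 1 - v 1 * w 0)⁻¹ •
        !₂[w 1 * y 0 - w 0 * y 1, v 0 * y 1 - v 1 * y 0]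
      left_inv := fun x => by
        ext i
        fin_cases i <;> simp <;> field_simp <;> ring
      right_inv := fun y => by
        ext i
        fin_cases i <;> simp <;> field_simp <;> ring }

@[simp] theorem columnEquiv_apply (v w : Plane) (h : v 0 * w 1 - v 1 * w 0 ≠ 0) (x : Plane) :
    columnEquiv v w h x = x 0 • v + x 1 • w := rfl

/-! ### One-sided cutoffs -/

/-- A smooth function on the line, `1` on `(-∞, 1/3]` and `0` on `[2/3, ∞)`. -/
def cutoff (s : ℝ) : ℝ := Real.smoothTransition (2 - 3 * s)

theorem contDiff_cutoff : ContDiff ℝ ∞ cutoff :=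
  Real.smoothTransition.contDiff.comp (contDiff_const.sub (contDiff_const.mul contDiff_id))

theorem cutoff_eq_one {s : ℝ} (h : s ≤ 1 / 3) : cutoff s = 1 :=
  Real.smoothTransition.one_of_one_le (by linarith)

theorem cutoff_eq_zero {s : ℝ} (h : 2 / 3 ≤ s) : cutoff s = 0 :=
  Real.smoothTransition.zero_of_nonpos (by linarith)

theorem cutoff_nonneg (s : ℝ) : 0 ≤ cutoff s := Real.smoothTransition.nonneg _

theorem cutoff_le_one (s : ℝ) : cutoff s ≤ 1 := Real.smoothTransition.le_one _

theorem hasDerivAt_cutoff (s : ℝ) : HasDerivAt cutoff (deriv cutoff s) s :=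
  (contDiff_cutoff.differentiable (by simp)).differentiableAt.hasDerivAt

theorem continuous_deriv_cutoff : Continuous (deriv cutoff) :=
  contDiff_cutoff.continuous_deriv (by simp)

theorem contDiff_deriv_cutoff : ContDiff ℝ ∞ (deriv cutoff) :=
  (contDiff_infty_iff_deriv.1 contDiff_cutoff).2

theorem deriv_cutoff_of_lt {s : ℝ} (h : s < 1 / 3) : deriv cutoff s = 0 := by
  have : cutoff =ᶠ[𝓝 s] fun _ => 1 := by
    filter_upwards [Iio_mem_nhds h] with t ht using cutoff_eq_one (le_of_lt ht)
  rw [this.deriv_eq, deriv_const]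

theorem deriv_cutoff_of_gt {s : ℝ} (h : 2 / 3 < s) : deriv cutoff s = 0 := by
  have : cutoff =ᶠ[𝓝 s] fun _ => 0 := by
    filter_upwards [Ioi_mem_nhds h] with t ht using cutoff_eq_zero (le_of_lt ht)
  rw [this.deriv_eq, deriv_const]

theorem integral_deriv_cutoff : ∫ s in (0 : ℝ)..1, deriv cutoff s = -1 := by
  rw [intervalIntegral.integral_eq_sub_of_hasDerivAt (fun s _ => hasDerivAt_cutoff s)
    (continuous_deriv_cutoff.intervalIntegrable _ _), cutoff_eq_zero (by norm_num),
    cutoff_eq_one (by norm_num)]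
  norm_num

theorem hasDerivAt_cutoff_div (h s : ℝ) :
    HasDerivAt (fun s => cutoff (s / h)) (h⁻¹ * deriv cutoff (s / h)) s := by
  have := (hasDerivAt_cutoff (s / h)).comp s ((hasDerivAt_id s).div_const h)
  simp only [id_eq, one_div] at this
  rw [mul_comm]
  exact this

theorem integral_mul_deriv_cutoff_div {v : ℝ → ℝ} {h : ℝ} (hh : 0 < h) :
    ∫ s in (0 : ℝ)..h, v s * (h⁻¹ * deriv cutoff (s / h)) =
      ∫ σ in (0 : ℝ)..1, v (h * σ) * deriv cutoff σ := by
  have := intervalIntegral.inv_smul_integral_comp_div (a := 0) (b := h)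
    (fun σ => v (h * σ) * deriv cutoff σ) h
  rw [zero_div, div_self hh.ne'] at this
  rw [← this, smul_eq_mul, ← intervalIntegral.integral_const_mul]
  refine intervalIntegral.integral_congr fun s _ => ?_
  rw [mul_div_cancel₀ _ hh.ne']
  ring

/-- The kernel `h⁻¹ * deriv cutoff (s / h)` lives on `0 < s < h` and has integral `-1`, so it
approximates minus the point mass at `0` from the right. After the substitution `s = h σ` the limit
is continuity in the parameter `h`. -/
theorem tendsto_integral_mul_deriv_cutoff_div {v : ℝ → ℝ} (hv : Continuous v) :
    Tendsto (fun h => ∫ s in (0 : ℝ)..1, v s * (h⁻¹ * deriv cutoff (s / h))) (𝓝[>] 0)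
      (𝓝 (-v 0)) := by
  have hc : Continuous fun h : ℝ => ∫ σ in (0 : ℝ)..1, v (h * σ) * deriv cutoff σ :=
    intervalIntegral.continuous_parametric_intervalIntegral_of_continuous'
      (by have := continuous_deriv_cutoff; fun_prop) _ _
  have h0 : ∫ σ in (0 : ℝ)..1, v (0 * σ) * deriv cutoff σ = -v 0 := by
    simp [intervalIntegral.integral_const_mul, integral_deriv_cutoff]
  rw [← h0]
  refine ((hc.tendsto 0).mono_left nhdsWithin_le_nhds).congr' ?_
  filter_upwards [Ioo_mem_nhdsGT (zero_lt_one' ℝ)] with h hh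
  have hi : ∀ a b, IntervalIntegrable (fun s => v s * (h⁻¹ * deriv cutoff (s / h))) volume a b :=
    fun a b => Continuous.intervalIntegrable
      (by have := continuous_deriv_cutoff; fun_prop) _ _
  rw [← integral_mul_deriv_cutoff_div hh.1,
    ← intervalIntegral.integral_add_adjacent_intervals (hi 0 h) (hi h 1)]
  have : ∫ s in h..1, v s * (h⁻¹ * deriv cutoff (s / h)) = 0 := by
    refine intervalIntegral.integral_zero_ae (ae_of_all _ fun s hs => ?_)
    rw [uIoc_of_le hh.2.le] at hs
    rw [deriv_cutoff_of_gt, mul_zero, mul_zero]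
    have : 1 < s / h := (one_lt_div hh.1).2 hs.1
    linarith
  rw [this, add_zero]

/-! ### Integrals over rectangles and segments -/

/-- The half-open rectangle `(a, b] × (c, d]`. -/
def rectangle (a b c d : ℝ) : Set Plane := {x | x 0 ∈ Ioc a b ∧ x 1 ∈ Ioc c d}

theorem setIntegral_rectangle {F : Plane → ℝ} (hF : Continuous F) {a b c d : ℝ} (hab : a ≤ b)
    (hcd : c ≤ d) :
    ∫ x in rectangle a b c d, F x = ∫ t in a..b, ∫ s in c..d, F !₂[t, s] := by
  set e : Plane ≃ᵐ ℝ × ℝ :=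
    (MeasurableEquiv.toLp 2 (Fin 2 → ℝ)).symm.trans MeasurableEquiv.finTwoArrow with he
  have hmp : MeasurePreserving e :=
    (EuclideanSpace.volume_preserving_symm_measurableEquiv_toLp (Fin 2)).trans
      (volume_preserving_finTwoArrow ℝ)
  have hmp' := hmp.symm
  have hes : ∀ z : ℝ × ℝ, e.symm z = !₂[z.1, z.2] := fun z => by
    rw [MeasurableEquiv.symm_apply_eq]
    rfl
  have hpre : e.symm ⁻¹' rectangle a b c d = Ioc a b ×ˢ Ioc c d := by
    ext z
    rw [mem_preimage, hes]
    simp [rectangle]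
  rw [← hmp'.setIntegral_preimage_emb e.symm.measurableEmbedding, hpre]
  simp_rw [hes]
  have hc : Continuous fun z : ℝ × ℝ => F !₂[z.1, z.2] := by
    refine hF.comp ((PiLp.continuous_toLp 2 _).comp (continuous_pi fun i => ?_))
    fin_cases i
    · exact continuous_fst
    · exact continuous_snd
  rw [Measure.volume_eq_prod, setIntegral_prod]
  · rw [intervalIntegral.integral_of_le hab]
    refine setIntegral_congr_fun measurableSet_Ioc fun t _ => ?_
    exact (intervalIntegral.integral_of_le hcd).symm
  · exact (hc.continuousOn.integrableOn_compact (isCompact_Icc.prod isCompact_Icc)).mono_set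
      (prod_mono Ioc_subset_Icc_self Ioc_subset_Icc_self)

theorem memLp_of_continuous_of_isBounded {U : Set Plane} (hU : Bornology.IsBounded U)
    {m : Plane → ℝ} (hm : Continuous m) : MemLp m 2 (volume.restrict U) := by
  have hK : IsCompact (closure U) := hU.isCompact_closure
  obtain ⟨C, hC⟩ := hK.exists_bound_of_continuousOn hm.continuousOn
  have : IsFiniteMeasure (volume.restrict U) :=
    ⟨by rw [Measure.restrict_apply_univ]; exact hU.measure_lt_top⟩
  have h1 : MemLp m 2 (volume.restrict (closure U)) := by
    have : IsFiniteMeasure (volume.restrict (closure U)) :=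
      ⟨by rw [Measure.restrict_apply_univ]; exact hK.measure_lt_top⟩
    refine MemLp.of_bound hm.aestronglyMeasurable C ?_
    exact ae_restrict_of_forall_mem isClosed_closure.measurableSet hC
  exact h1.mono_measure (Measure.restrict_mono subset_closure le_rfl)

theorem tendsto_integral_mul_of_tendsto_eLpNorm {μ : Measure Plane} {F : ℕ → Plane → ℝ}
    {f m : Plane → ℝ} (hm : MemLp m 2 μ) (hf : MemLp f 2 μ) (hF : ∀ k, AEStronglyMeasurable (F k) μ)
    (h : Tendsto (fun k => eLpNorm (fun x => F k x - f x) 2 μ) atTop (𝓝 0)) :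
    Tendsto (fun k => ∫ x, F k x * m x ∂μ) atTop (𝓝 (∫ x, f x * m x ∂μ)) := by
  have hd : ∀ k, AEStronglyMeasurable (fun x => F k x - f x) μ := fun k => (hF k).sub hf.1
  refine tendsto_integral_of_L1' (fun x => f x * m x) (hf.1.mul hm.1) ?_ ?_
  · filter_upwards [h.eventually_lt_const (ENNReal.zero_lt_top)] with k hk
    have h1 : MemLp (fun x => F k x - f x) 2 μ := ⟨hd k, hk⟩
    have h2 : MemLp (F k) 2 μ := by
      have := h1.add hf
      rwa [show (fun x => F k x - f x) + f = F k by funext x; simp] at this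
    exact h2.integrable_mul hm
  · have h1 : Tendsto (fun k => eLpNorm (fun x => F k x - f x) 2 μ * eLpNorm m 2 μ) atTop
        (𝓝 (0 * eLpNorm m 2 μ)) := ENNReal.Tendsto.mul_const h (Or.inr hm.2.ne)
    rw [zero_mul] at h1
    refine tendsto_of_tendsto_of_tendsto_of_le_of_le tendsto_const_nhds h1 (fun _ => zero_le)
      fun k => ?_
    have h2 : ((fun x => F k x * m x) - fun x => f x * m x) = (fun x => F k x - f x) • m := by
      funext x
      simp [sub_mul]
    rw [h2]
    exact eLpNorm_smul_le_mul_eLpNorm hm.1 (hd k)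

instance (p q : Plane) : IsFiniteMeasure (segmentMeasure p q) := by
  rw [segmentMeasure]
  have : IsFiniteMeasure (ENNReal.ofReal (dist p q) • volume.restrict (Icc (0 : ℝ) 1)) :=
    Measure.smul_finite _ ENNReal.ofReal_ne_top
  infer_instance

theorem measurableEmbedding_lineMap {p q : Plane} (hpq : p ≠ q) :
    MeasurableEmbedding (AffineMap.lineMap p q : ℝ → Plane) :=
  AffineMap.lineMap_continuous.measurableEmbedding (AffineMap.lineMap_injective ℝ hpq)

theorem integral_segmentMeasure {p q : Plane} (hpq : p ≠ q) (F : Plane → ℝ) :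
    ∫ x, F x ∂segmentMeasure p q =
      dist p q * ∫ t in (0 : ℝ)..1, F (AffineMap.lineMap p q t) := by
  rw [segmentMeasure, (measurableEmbedding_lineMap hpq).integral_map, integral_smul_measure,
    ENNReal.toReal_ofReal dist_nonneg, smul_eq_mul, intervalIntegral.integral_of_le zero_le_one,
    integral_Icc_eq_integral_Ioc]

theorem memLp_segmentMeasure_comp {p q : Plane} (hpq : p ≠ q) {F : Plane → ℝ}
    (hF : MemLp F 2 (segmentMeasure p q)) :
    IntervalIntegrable (fun t => F (AffineMap.lineMap p q t)) volume 0 1 := by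
  rw [segmentMeasure, (measurableEmbedding_lineMap hpq).memLp_map_measure_iff] at hF
  have hd : ENNReal.ofReal (dist p q) ≠ 0 := by simpa using hpq
  have h1 := hF.smul_measure (ENNReal.inv_ne_top.2 hd)
  rw [smul_smul, ENNReal.inv_mul_cancel hd ENNReal.ofReal_ne_top, one_smul] at h1
  rw [intervalIntegrable_iff_integrableOn_Icc_of_le zero_le_one]
  exact h1.integrable (by norm_num)

theorem partialDeriv_zero_mul {a b : ℝ → ℝ} (ha : Differentiable ℝ a) (hb : Differentiable ℝ b)
    (x : Plane) :
    partialDeriv 0 (fun x : Plane => a (x 0) * b (x 1)) x = deriv a (x 0) * b (x 1) := by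
  have hp : ∀ i : Fin 2, HasFDerivAt (fun x : Plane => x i)
      (EuclideanSpace.proj i : Plane →L[ℝ] ℝ) x := fun i =>
    (EuclideanSpace.proj i : Plane →L[ℝ] ℝ).hasFDerivAt
  have h := ((ha (x 0)).hasDerivAt.comp_hasFDerivAt x (hp 0)).mul
    ((hb (x 1)).hasDerivAt.comp_hasFDerivAt x (hp 1))
  have h' : HasFDerivAt (fun x : Plane => a (x 0) * b (x 1)) _ x := h
  rw [partialDeriv, h'.fderiv]
  simp [mul_comm]

theorem hasDerivAt_vertical {φ : Plane → ℝ} (hφ : ContDiff ℝ ∞ φ) (t s : ℝ) :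
    HasDerivAt (fun s => φ !₂[t, s]) (partialDeriv 1 φ !₂[t, s]) s := by
  have h1 : HasDerivAt (fun s : ℝ => (!₂[t, s] : Plane)) (EuclideanSpace.single 1 1) s := by
    have h2 : (fun s : ℝ => (!₂[t, s] : Plane)) =
        fun s => !₂[t, 0] + s • EuclideanSpace.single 1 (1 : ℝ) := by
      funext s
      ext i
      fin_cases i <;> simp
    rw [h2]
    simpa using ((hasDerivAt_id s).smul_const (EuclideanSpace.single 1 (1 : ℝ) : Plane)).const_add
      (!₂[t, 0] : Plane)
  exact ((hφ.differentiable (by simp)) _).hasFDerivAt.comp_hasDerivAt s h1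

theorem continuous_plane_mk {X : Type*} [TopologicalSpace X] {f g : X → ℝ} (hf : Continuous f)
    (hg : Continuous g) : Continuous fun x => (!₂[f x, g x] : Plane) := by
  refine (PiLp.continuous_toLp 2 _).comp (continuous_pi fun i => ?_)
  fin_cases i
  · exact hf
  · exact hg

/-- Because `h < δ`, the rectangle lies below the line `x 0 + x 1 = 1` and hence inside `U`.
Integrals of functions concentrated there can then be computed by Fubini, whatever `U` is elsewhere.
-/
theorem setIntegral_eq_setIntegral_rectangle {U : Set Plane} (hUo : IsOpen U)
    (hUp : ∀ x ∈ U, 0 < x 1) (hU : ∀ x : Plane, 0 < x 0 → 0 < x 1 → x 0 + x 1 < 1 → x ∈ U)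
    {δ h : ℝ} (hδ : 0 < δ) (hh : h < δ) {F : Plane → ℝ}
    (hF : ∀ x, 0 < x 1 → (x 0 ∉ Ioo δ (1 - δ) ∨ h < x 1) → F x = 0) :
    ∫ x in U, F x = ∫ x in rectangle δ (1 - δ) 0 h, F x := by
  refine setIntegral_eq_of_subset_of_forall_sdiff_eq_zero hUo.measurableSet ?_ ?_
  · rintro x ⟨⟨h1, h2⟩, h3, h4⟩
    exact hU x (hδ.trans h1) h3 (by linarith)
  · rintro x ⟨hx, hx'⟩
    have h1 := hUp x hx
    refine hF x h1 ?_
    by_contra! h2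
    exact hx' ⟨Ioo_subset_Ioc_self h2.1, h1, h2.2⟩

theorem intervalIntegral_eq_of_eq_zero {f : ℝ → ℝ} {δ : ℝ} (hδ : 0 < δ)
    (hf : ∀ t, t ∉ Ioo δ (1 - δ) → f t = 0) :
    ∫ t in δ..(1 - δ), f t = ∫ t in (0 : ℝ)..1, f t := by
  have h : Function.support f ⊆ Ioo δ (1 - δ) := fun t ht => by
    by_contra h
    exact ht (hf t h)
  rw [intervalIntegral.integral_eq_integral_of_support_subset (h.trans Ioo_subset_Ioc_self),
    intervalIntegral.integral_eq_integral_of_support_subset (h.trans fun t ht =>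
      ⟨hδ.trans ht.1, by linarith [ht.2]⟩)]

/-! ### Traces on the horizontal edge by testing in a thin layer -/

section Reference

variable {U : Set Plane} {χ : ℝ → ℝ} {δ h : ℝ}

/-- Integration by parts in the vertical variable with weight `χ (x 0) * cutoff (x 1 / h)`. The
weight vanishes near the other edges, so only the boundary term on the horizontal edge survives. -/
theorem setIntegral_green (hUo : IsOpen U) (hUb : Bornology.IsBounded U)
    (hUp : ∀ x ∈ U, 0 < x 1) (hU : ∀ x : Plane, 0 < x 0 → 0 < x 1 → x 0 + x 1 < 1 → x ∈ U)
    (hχ : ContDiff ℝ ∞ χ) (hδ : 0 < δ) (hδ' : δ < 1 / 2) (hs : tsupport χ ⊆ Ioo δ (1 - δ))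
    (h0 : 0 < h) (hh : h < δ) {φ : Plane → ℝ} (hφ : ContDiff ℝ ∞ φ) :
    (∫ x in U, partialDeriv 1 φ x * (χ (x 0) * cutoff (x 1 / h))) +
      ∫ x in U, φ x * (χ (x 0) * (h⁻¹ * deriv cutoff (x 1 / h))) =
    -∫ t in (0 : ℝ)..1, φ !₂[t, 0] * χ t := by
  have hχ0 : ∀ t, t ∉ Ioo δ (1 - δ) → χ t = 0 := fun t ht =>
    image_eq_zero_of_notMem_tsupport fun h => ht (hs h)
  have c1 := continuous_deriv_cutoff
  have c2 := contDiff_cutoff.continuous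
  have c3 := hχ.continuous
  have c4 := hφ.continuous
  have c5 := continuous_partialDeriv hφ 1
  have hm1 : Continuous fun x : Plane => χ (x 0) * cutoff (x 1 / h) := by fun_prop
  have hm2 : Continuous fun x : Plane => χ (x 0) * (h⁻¹ * deriv cutoff (x 1 / h)) := by fun_prop
  have hi1 : Integrable (fun x : Plane => partialDeriv 1 φ x * (χ (x 0) * cutoff (x 1 / h)))
      (volume.restrict U) :=
    (memLp_of_continuous_of_isBounded hUb c5).integrable_mul
      (memLp_of_continuous_of_isBounded hUb hm1)
  have hi2 : Integrable (fun x : Plane => φ x * (χ (x 0) * (h⁻¹ * deriv cutoff (x 1 / h))))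
      (volume.restrict U) :=
    (memLp_of_continuous_of_isBounded hUb c4).integrable_mul
      (memLp_of_continuous_of_isBounded hUb hm2)
  rw [← integral_add hi1 hi2, setIntegral_eq_setIntegral_rectangle hUo hUp hU hδ hh,
    setIntegral_rectangle (by fun_prop) (by linarith) h0.le]
  · have e : ∀ t, ∫ s in (0 : ℝ)..h, (partialDeriv 1 φ !₂[t, s] * (χ t * cutoff (s / h)) +
        φ !₂[t, s] * (χ t * (h⁻¹ * deriv cutoff (s / h)))) = -(φ !₂[t, 0] * χ t) := fun t => by
      -- On each vertical line the integrand is an exact derivative; the cutoff is `0` at the top `s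
      -- = h` and `1` at the bottom `s = 0`.
      have hd : ∀ s, HasDerivAt (fun s => χ t * (φ !₂[t, s] * cutoff (s / h)))
          (partialDeriv 1 φ !₂[t, s] * (χ t * cutoff (s / h)) +
            φ !₂[t, s] * (χ t * (h⁻¹ * deriv cutoff (s / h)))) s := fun s => by
        convert! ((hasDerivAt_vertical hφ t s).mul (hasDerivAt_cutoff_div h s)).const_mul (χ t)
          using 1
        ring
      have cv : Continuous fun s : ℝ => (!₂[t, s] : Plane) :=
        continuous_plane_mk continuous_const continuous_id
      rw [intervalIntegral.integral_eq_sub_of_hasDerivAt (fun s _ => hd s)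
        (Continuous.intervalIntegrable (by fun_prop) _ _), div_self h0.ne',
        cutoff_eq_zero (by norm_num), zero_div, cutoff_eq_one (by norm_num)]
      ring
    have e' : ∀ t, ∫ s in (0 : ℝ)..h,
        (fun x : Plane => partialDeriv 1 φ x * (χ (x 0) * cutoff (x 1 / h)) +
          φ x * (χ (x 0) * (h⁻¹ * deriv cutoff (x 1 / h)))) !₂[t, s] = -(φ !₂[t, 0] * χ t) := e
    simp_rw [e']
    rw [intervalIntegral_eq_of_eq_zero hδ fun t ht => by rw [hχ0 t ht]; ring,
      intervalIntegral.integral_neg]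
  · rintro x hx (hx0 | hx1)
    · simp [hχ0 _ hx0]
    · have : 1 < x 1 / h := (one_lt_div h0).2 hx1
      rw [cutoff_eq_zero (by linarith), deriv_cutoff_of_gt (by linarith)]
      ring

theorem setIntegral_mul_deriv_cutoff (hUo : IsOpen U)
    (hUp : ∀ x ∈ U, 0 < x 1) (hU : ∀ x : Plane, 0 < x 0 → 0 < x 1 → x 0 + x 1 < 1 → x ∈ U)
    (hχ : ContDiff ℝ ∞ χ) (hδ : 0 < δ) (hδ' : δ < 1 / 2) (hs : tsupport χ ⊆ Ioo δ (1 - δ))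
    {W : Plane → ℝ} (hW : Continuous W) :
    Tendsto (fun h => ∫ x in U, W x * (deriv χ (x 0) * (h⁻¹ * deriv cutoff (x 1 / h))))
      (𝓝[>] 0) (𝓝 (-∫ t in (0 : ℝ)..1, W !₂[t, 0] * deriv χ t)) := by
  have hχ0 : ∀ t, t ∉ Ioo δ (1 - δ) → deriv χ t = 0 := fun t ht => by
    by_contra h
    exact ht (hs (support_deriv_subset h))
  have c1 := continuous_deriv_cutoff
  have c2 : Continuous (deriv χ) := hχ.continuous_deriv (by simp)
  -- The rescaled integral with `s = h σ` makes sense and is continuous also at `h = 0`, where the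
  -- inner integral is `-1` times the boundary value.
  have hc : Continuous fun h : ℝ => ∫ t in δ..(1 - δ), ∫ σ in (0 : ℝ)..1,
      W !₂[t, h * σ] * deriv χ t * deriv cutoff σ := by
    refine intervalIntegral.continuous_parametric_intervalIntegral_of_continuous' ?_ _ _
    refine intervalIntegral.continuous_parametric_intervalIntegral_of_continuous' ?_ _ _
    have : Continuous fun p : (ℝ × ℝ) × ℝ => (!₂[p.1.2, p.1.1 * p.2] : Plane) :=
      continuous_plane_mk (by fun_prop) (by fun_prop)
    simp only [Function.uncurry_def]
    fun_prop
  have h0 : ∫ t in δ..(1 - δ), ∫ σ in (0 : ℝ)..1,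
      W !₂[t, 0 * σ] * deriv χ t * deriv cutoff σ =
      -∫ t in (0 : ℝ)..1, W !₂[t, 0] * deriv χ t := by
    simp_rw [zero_mul, intervalIntegral.integral_const_mul, integral_deriv_cutoff]
    rw [← intervalIntegral.integral_neg]
    rw [intervalIntegral_eq_of_eq_zero hδ fun t ht => by rw [hχ0 t ht]; ring]
    simp
  rw [← h0]
  refine ((hc.tendsto 0).mono_left nhdsWithin_le_nhds).congr' ?_
  filter_upwards [Ioo_mem_nhdsGT hδ] with h hh
  rw [setIntegral_eq_setIntegral_rectangle hUo hUp hU hδ hh.2,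
    setIntegral_rectangle (by fun_prop) (by linarith) hh.1.le]
  · refine intervalIntegral.integral_congr fun t _ => ?_
    have := integral_mul_deriv_cutoff_div (v := fun s => W !₂[t, s] * deriv χ t) hh.1
    rw [← this]
    refine intervalIntegral.integral_congr fun s _ => ?_
    simp only [Matrix.cons_val_zero, Matrix.cons_val_one]
    ring
  · rintro x hx (hx0 | hx1)
    · simp [hχ0 _ hx0]
    · have : 1 < x 1 / h := (one_lt_div hh.1).2 hx1
      rw [deriv_cutoff_of_gt (by linarith)]
      ring

/-- Dominated convergence: each point of `U` has positive height and leaves the layer once `h` is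
small. -/
theorem tendsto_setIntegral_mul_cutoff (hUb : Bornology.IsBounded U)
    (hUo : IsOpen U) (hUp : ∀ x ∈ U, 0 < x 1) (hχ : Continuous χ) {g : Plane → ℝ}
    (hg : MemLp g 2 (volume.restrict U)) :
    Tendsto (fun h => ∫ x in U, g x * (χ (x 0) * cutoff (x 1 / h))) (𝓝[>] 0) (𝓝 0) := by
  have c2 := contDiff_cutoff.continuous
  have hm : Continuous fun x : Plane => χ (x 0) := by fun_prop
  have hi : Integrable (fun x => g x * χ (x 0)) (volume.restrict U) :=
    hg.integrable_mul (memLp_of_continuous_of_isBounded hUb hm)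
  have h := tendsto_integral_filter_of_dominated_convergence (μ := volume.restrict U)
    (l := 𝓝[>] (0 : ℝ)) (F := fun h x => g x * (χ (x 0) * cutoff (x 1 / h))) (f := fun _ => 0)
    (fun x => ‖g x * χ (x 0)‖) ?_ ?_ hi.norm ?_
  · simpa using h
  · refine Eventually.of_forall fun h => hg.1.mul (Continuous.aestronglyMeasurable (by fun_prop))
  · refine Eventually.of_forall fun h => ae_of_all _ fun x => ?_
    rw [← mul_assoc, norm_mul]
    refine mul_le_of_le_one_right (norm_nonneg _) ?_
    rw [Real.norm_of_nonneg (cutoff_nonneg _)]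
    exact cutoff_le_one _
  · refine ae_restrict_of_forall_mem hUo.measurableSet fun x hx => ?_
    have hx1 := hUp x hx
    refine tendsto_const_nhds.congr' ?_
    filter_upwards [Ioo_mem_nhdsGT hx1] with h hh
    have : 1 < x 1 / h := (one_lt_div hh.1).2 hh.2
    rw [cutoff_eq_zero (by linarith)]
    ring

/-- The derivative of the cutoff vanishes near the edge as well as above the layer, so `χ (x 0) *
(h⁻¹ * deriv cutoff (x 1 / h))` is a legitimate test function with compact support in `U`. -/
theorem HasWeakPartial.setIntegral_deriv_mul (hUb : Bornology.IsBounded U)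
    (hU : ∀ x : Plane, 0 < x 0 → 0 < x 1 → x 0 + x 1 < 1 → x ∈ U)
    (hχ : ContDiff ℝ ∞ χ) (hδ : 0 < δ) (hs : tsupport χ ⊆ Ioo δ (1 - δ)) (h0 : 0 < h)
    (hh : h < δ) {W g : Plane → ℝ} (hW : HasWeakPartial U 0 W g) :
    ∫ x in U, W x * (deriv χ (x 0) * (h⁻¹ * deriv cutoff (x 1 / h))) =
      -∫ x in U, g x * (χ (x 0) * (h⁻¹ * deriv cutoff (x 1 / h))) := by
  have hb : ContDiff ℝ ∞ fun s => h⁻¹ * deriv cutoff (s / h) :=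
    contDiff_const.mul (contDiff_deriv_cutoff.comp (contDiff_id.div_const h))
  have hp : ∀ i : Fin 2, ContDiff ℝ ∞ fun x : Plane => x i := fun i =>
    (EuclideanSpace.proj i : Plane →L[ℝ] ℝ).contDiff
  have hψ : ContDiff ℝ ∞ fun x : Plane => χ (x 0) * (h⁻¹ * deriv cutoff (x 1 / h)) :=
    (hχ.comp (hp 0)).mul (hb.comp (hp 1))
  have hsub : tsupport (fun x : Plane => χ (x 0) * (h⁻¹ * deriv cutoff (x 1 / h))) ⊆ U := by
    have hcl : IsClosed {x : Plane | x 0 ∈ tsupport χ ∧ x 1 ∈ Icc (h / 3) (2 * h / 3)} :=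
      ((isClosed_tsupport χ).preimage (by fun_prop)).inter (isClosed_Icc.preimage (by fun_prop))
    have h1 : tsupport (fun x : Plane => χ (x 0) * (h⁻¹ * deriv cutoff (x 1 / h))) ⊆
        {x : Plane | x 0 ∈ tsupport χ ∧ x 1 ∈ Icc (h / 3) (2 * h / 3)} := by
      refine closure_minimal (fun x hx => ?_) hcl
      rw [Function.mem_support] at hx
      refine ⟨subset_tsupport _ (left_ne_zero_of_mul hx), ?_⟩
      have h2 := right_ne_zero_of_mul (right_ne_zero_of_mul hx)
      constructor
      · by_contra! h3
        refine h2 (deriv_cutoff_of_lt ?_)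
        rw [div_lt_iff₀ h0]
        linarith
      · by_contra! h3
        refine h2 (deriv_cutoff_of_gt ?_)
        rw [lt_div_iff₀ h0]
        linarith
    refine h1.trans fun x hx => ?_
    have h2 := hs hx.1
    exact hU x (hδ.trans h2.1) (by linarith [hx.2.1]) (by linarith [h2.2, hx.2.2])
  have hcs : HasCompactSupport fun x : Plane => χ (x 0) * (h⁻¹ * deriv cutoff (x 1 / h)) :=
    hUb.isCompact_closure.of_isClosed_subset (isClosed_tsupport _) (hsub.trans subset_closure)
  have h1 := hW _ hψ hcs hsub
  have h2 : ∀ x : Plane,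
      partialDeriv 0 (fun x : Plane => χ (x 0) * (h⁻¹ * deriv cutoff (x 1 / h))) x =
      deriv χ (x 0) * (h⁻¹ * deriv cutoff (x 1 / h)) :=
    partialDeriv_zero_mul (hχ.differentiable (by simp)) (hb.differentiable (by simp))
  simpa only [h2] using h1

theorem lineMap_reference (t : ℝ) :
    AffineMap.lineMap (!₂[0, 0] : Plane) !₂[1, 0] t = !₂[t, 0] := by
  ext i
  fin_cases i <;> simp [AffineMap.lineMap_apply]

theorem reference_ne : (!₂[0, 0] : Plane) ≠ !₂[1, 0] := fun h => by
  have := congrFun (congrArg WithLp.ofLp h) 0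
  simp at this

theorem dist_reference : dist (!₂[0, 0] : Plane) !₂[1, 0] = 1 := by
  simp [EuclideanSpace.dist_eq]

theorem integral_segmentMeasure_reference (F : Plane → ℝ) :
    ∫ x, F x ∂segmentMeasure !₂[0, 0] !₂[1, 0] = ∫ t in (0 : ℝ)..1, F !₂[t, 0] := by
  simp_rw [integral_segmentMeasure reference_ne, dist_reference, one_mul, lineMap_reference]

/-- For fixed `h` every term of the smooth identity is continuous along the approximating sequence
in the definition of the trace. -/
theorem HasTrace.setIntegral_green (hUo : IsOpen U) (hUb : Bornology.IsBounded U)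
    (hUp : ∀ x ∈ U, 0 < x 1) (hU : ∀ x : Plane, 0 < x 0 → 0 < x 1 → x 0 + x 1 < 1 → x ∈ U)
    (hχ : ContDiff ℝ ∞ χ) (hδ : 0 < δ) (hδ' : δ < 1 / 2) (hs : tsupport χ ⊆ Ioo δ (1 - δ))
    (h0 : 0 < h) (hh : h < δ) {g T : Plane → ℝ} {dg : Fin 2 → Plane → ℝ}
    (hg : MemLp g 2 (volume.restrict U)) (hdg : MemLp (dg 1) 2 (volume.restrict U))
    (hT : HasTrace U !₂[0, 0] !₂[1, 0] g dg T) :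
    (∫ x in U, dg 1 x * (χ (x 0) * cutoff (x 1 / h))) +
      ∫ x in U, g x * (χ (x 0) * (h⁻¹ * deriv cutoff (x 1 / h))) =
    -∫ t in (0 : ℝ)..1, T !₂[t, 0] * χ t := by
  obtain ⟨hTm, φ, hφ, l1, l2, l3⟩ := hT
  have c1 := continuous_deriv_cutoff
  have c2 := contDiff_cutoff.continuous
  have c3 := hχ.continuous
  have hm1 : Continuous fun x : Plane => χ (x 0) * cutoff (x 1 / h) := by fun_prop
  have hm2 : Continuous fun x : Plane => χ (x 0) * (h⁻¹ * deriv cutoff (x 1 / h)) := by fun_prop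
  have k1 := tendsto_integral_mul_of_tendsto_eLpNorm (memLp_of_continuous_of_isBounded hUb hm1) hdg
    (fun k => (continuous_partialDeriv (hφ k) 1).aestronglyMeasurable) (l2 1)
  have k2 := tendsto_integral_mul_of_tendsto_eLpNorm (memLp_of_continuous_of_isBounded hUb hm2) hg
    (fun k => (hφ k).continuous.aestronglyMeasurable) l1
  have hmχ : MemLp (fun x : Plane => χ (x 0)) 2 (segmentMeasure !₂[0, 0] !₂[1, 0]) := by
    have hcs : HasCompactSupport χ := isCompact_Icc.of_isClosed_subset (isClosed_tsupport χ)
      (hs.trans Ioo_subset_Icc_self)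
    obtain ⟨C, hC⟩ := hcs.exists_bound_of_continuous c3
    exact MemLp.of_bound (Continuous.aestronglyMeasurable (by fun_prop)) C
      (ae_of_all _ fun x => hC _)
  have k3 := tendsto_integral_mul_of_tendsto_eLpNorm hmχ hTm
    (fun k => (hφ k).continuous.aestronglyMeasurable) l3
  simp_rw [integral_segmentMeasure_reference] at k3
  refine tendsto_nhds_unique (k1.add k2) (k3.neg.congr fun k => ?_)
  exact (FujinoMorley.setIntegral_green hUo hUb hUp hU hχ hδ hδ' hs h0 hh (hφ k)).symm

/-- This says that `T` is the weak derivative of the boundary values of `W` along the edge. Move the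
horizontal derivative from `W` to `χ` inside the layer, combine with Green's formula, and let `h →
0`. -/
theorem HasTrace.integral_mul_eq (hUo : IsOpen U) (hUb : Bornology.IsBounded U)
    (hUp : ∀ x ∈ U, 0 < x 1) (hU : ∀ x : Plane, 0 < x 0 → 0 < x 1 → x 0 + x 1 < 1 → x ∈ U)
    (hχ : ContDiff ℝ ∞ χ) (hδ : 0 < δ) (hδ' : δ < 1 / 2) (hs : tsupport χ ⊆ Ioo δ (1 - δ))
    {W g T : Plane → ℝ} {dg : Fin 2 → Plane → ℝ} (hW : Continuous W)
    (hg : MemLp g 2 (volume.restrict U)) (hdg : MemLp (dg 1) 2 (volume.restrict U))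
    (hWg : HasWeakPartial U 0 W g) (hT : HasTrace U !₂[0, 0] !₂[1, 0] g dg T) :
    ∫ t in (0 : ℝ)..1, T !₂[t, 0] * χ t = -∫ t in (0 : ℝ)..1, W !₂[t, 0] * deriv χ t := by
  have k1 := tendsto_setIntegral_mul_cutoff (χ := χ) hUb hUo hUp hχ.continuous hdg
  have k2 := setIntegral_mul_deriv_cutoff hUo hUp hU hχ hδ hδ' hs hW
  refine tendsto_nhds_unique (f := fun _ : ℝ => ∫ t in (0 : ℝ)..1, T !₂[t, 0] * χ t)
    (l := 𝓝[>] (0 : ℝ)) tendsto_const_nhds ?_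
  have k3 := k2.sub k1
  rw [sub_zero] at k3
  refine k3.congr' ?_
  filter_upwards [Ioo_mem_nhdsGT hδ] with h hh
  have e1 := hT.setIntegral_green hUo hUb hUp hU hχ hδ hδ' hs hh.1 hh.2 hg hdg
  have e2 := hWg.setIntegral_deriv_mul hUb hU hχ hδ hs hh.1 hh.2
  linarith

end Reference

/-! ### Fundamental theorem of calculus along the edge -/

/-- A smooth function equal to `1` on `[2h/3, 1 - 2h/3]`, supported in `[h/3, 1 - h/3]`. -/
def plateau (h t : ℝ) : ℝ := 1 - cutoff (t / h) - cutoff ((1 - t) / h)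

theorem contDiff_plateau (h : ℝ) : ContDiff ℝ ∞ (plateau h) :=
  (contDiff_const.sub (contDiff_cutoff.comp (contDiff_id.div_const h))).sub
    (contDiff_cutoff.comp ((contDiff_const.sub contDiff_id).div_const h))

theorem deriv_plateau (h t : ℝ) :
    deriv (plateau h) t = h⁻¹ * deriv cutoff ((1 - t) / h) - h⁻¹ * deriv cutoff (t / h) := by
  have h1 := (hasDerivAt_cutoff_div h (1 - t)).comp t ((hasDerivAt_id t).const_sub 1)
  have h2 : HasDerivAt (plateau h) _ t :=
    ((hasDerivAt_cutoff_div h t).const_sub 1).sub h1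
  rw [h2.deriv]
  ring

theorem tsupport_plateau_subset {h : ℝ} (h0 : 0 < h) (h1 : h ≤ 1) :
    tsupport (plateau h) ⊆ Ioo (h / 4) (1 - h / 4) := by
  -- The closed support starts at `h / 3`; giving way to `h / 4` fits it into an open interval.
  have : tsupport (plateau h) ⊆ Icc (h / 3) (1 - h / 3) := by
    refine closure_minimal (fun t ht => ?_) isClosed_Icc
    rw [Function.mem_support, plateau] at ht
    constructor
    · by_contra! h2
      refine ht ?_
      rw [cutoff_eq_one, cutoff_eq_zero]
      · ring
      · rw [le_div_iff₀ h0]; linarith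
      · rw [div_le_iff₀ h0]; linarith
    · by_contra! h2
      refine ht ?_
      rw [cutoff_eq_zero (s := t / h), cutoff_eq_one]
      · ring
      · rw [div_le_iff₀ h0]; linarith
      · rw [le_div_iff₀ h0]; linarith
  exact this.trans fun t ht => ⟨by linarith [ht.1], by linarith [ht.2]⟩

theorem norm_plateau_le_one (h t : ℝ) : ‖plateau h t‖ ≤ 1 := by
  rw [Real.norm_eq_abs, abs_le, plateau]
  constructor <;> linarith [cutoff_nonneg (t / h), cutoff_nonneg ((1 - t) / h),
    cutoff_le_one (t / h), cutoff_le_one ((1 - t) / h)]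

theorem tendsto_integral_mul_plateau {f : ℝ → ℝ} (hf : IntervalIntegrable f volume 0 1) :
    Tendsto (fun h => ∫ t in (0 : ℝ)..1, f t * plateau h t) (𝓝[>] 0)
      (𝓝 (∫ t in (0 : ℝ)..1, f t)) := by
  refine intervalIntegral.tendsto_integral_filter_of_dominated_convergence (fun t => ‖f t‖)
    (Eventually.of_forall fun h => ?_) (Eventually.of_forall fun h => ae_of_all _ fun t _ => ?_)
    hf.norm ?_
  · exact hf.aestronglyMeasurable_restrict_uIoc.mul 
      (contDiff_plateau h).continuous.aestronglyMeasurable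
  · rw [norm_mul]
    exact mul_le_of_le_one_right (norm_nonneg _) (norm_plateau_le_one h t)
  · have h1 : ∀ᵐ t : ℝ, t ≠ 1 := by simp [ae_iff]
    filter_upwards [h1] with t ht ht'
    rw [uIoc_of_le zero_le_one] at ht'
    have ht1 : 0 < 1 - t := sub_pos.2 (lt_of_le_of_ne ht'.2 ht)
    refine tendsto_const_nhds.congr' ?_
    filter_upwards [Ioo_mem_nhdsGT ht'.1, Ioo_mem_nhdsGT ht1] with h h2 h3
    have h4 : 1 < t / h := (one_lt_div h2.1).2 h2.2
    have h5 : 1 < (1 - t) / h := (one_lt_div h3.1).2 h3.2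
    rw [plateau, cutoff_eq_zero (by linarith), cutoff_eq_zero (by linarith)]
    ring

/-- The derivative of the plateau approximates the point mass at `0` minus the one at `1`; the
second endpoint is reduced to the first by the reflection `t ↦ 1 - t`. -/
theorem tendsto_integral_mul_deriv_plateau {v : ℝ → ℝ} (hv : Continuous v) :
    Tendsto (fun h => ∫ t in (0 : ℝ)..1, v t * deriv (plateau h) t) (𝓝[>] 0)
      (𝓝 (v 0 - v 1)) := by
  have k1 := tendsto_integral_mul_deriv_cutoff_div hv
  have k2 := tendsto_integral_mul_deriv_cutoff_div (v := fun t => v (1 - t)) (by fun_prop)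
  have k3 := k2.sub k1
  have e : -v (1 - 0) - -v 0 = v 0 - v 1 := by rw [sub_zero]; ring
  rw [e] at k3
  refine k3.congr fun h => ?_
  have c1 := continuous_deriv_cutoff
  have e2 := intervalIntegral.integral_comp_sub_left (a := 0) (b := 1)
    (fun t => v t * (h⁻¹ * deriv cutoff ((1 - t) / h))) 1
  simp only [sub_sub_cancel, sub_self, sub_zero] at e2
  rw [e2, ← intervalIntegral.integral_sub (Continuous.intervalIntegrable (by fun_prop) _ _)
    (Continuous.intervalIntegrable (by fun_prop) _ _)]
  refine intervalIntegral.integral_congr fun t _ => ?_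
  simp only [deriv_plateau]
  ring

/-- Test the weak identity on the edge with `χ = plateau h` and let `h → 0`: the left side tends to
the full integral of the trace, the right side to the endpoint values. -/
theorem HasTrace.integral_eq_sub_of_continuous {U : Set Plane} (hUo : IsOpen U)
    (hUb : Bornology.IsBounded U)
    (hUp : ∀ x ∈ U, 0 < x 1) (hU : ∀ x : Plane, 0 < x 0 → 0 < x 1 → x 0 + x 1 < 1 → x ∈ U)
    {W g T : Plane → ℝ} {dg : Fin 2 → Plane → ℝ} (hW : Continuous W)
    (hg : MemLp g 2 (volume.restrict U)) (hdg : MemLp (dg 1) 2 (volume.restrict U))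
    (hWg : HasWeakPartial U 0 W g) (hT : HasTrace U !₂[0, 0] !₂[1, 0] g dg T) :
    ∫ t in (0 : ℝ)..1, T !₂[t, 0] = W !₂[1, 0] - W !₂[0, 0] := by
  have hTi : IntervalIntegrable (fun t => T !₂[t, 0]) volume 0 1 := by
    simpa only [lineMap_reference] using memLp_segmentMeasure_comp reference_ne hT.1
  have hv : Continuous fun t : ℝ => W !₂[t, 0] :=
    hW.comp (continuous_plane_mk continuous_id continuous_const)
  have k1 := tendsto_integral_mul_plateau hTi
  have k2 := (tendsto_integral_mul_deriv_plateau hv).neg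
  rw [neg_sub] at k2
  refine tendsto_nhds_unique k1 (k2.congr' ?_)
  filter_upwards [Ioo_mem_nhdsGT (zero_lt_one' ℝ)] with h hh
  exact (hT.integral_mul_eq hUo hUb hUp hU (contDiff_plateau h) (by linarith [hh.1] : 0 < h / 4)
    (by linarith [hh.2]) (tsupport_plateau_subset hh.1 hh.2.le) hW hg hdg hWg).symm

/-! ### The reference triangle -/

/-- The vertices of the reference triangle. -/
def referenceVertices : Fin 3 → Plane := ![!₂[0, 0], !₂[1, 0], !₂[0, 1]]

theorem triangle_reference_subset :
    triangle referenceVertices ⊆ {x | 0 ≤ x 1} := by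
  refine convexHull_min ?_ ?_
  · rintro _ ⟨i, rfl⟩
    fin_cases i <;> simp [referenceVertices]
  · exact convex_halfSpace_ge (f := fun x : Plane => x 1)
      ⟨fun _ _ => rfl, fun _ _ => rfl⟩ 0

theorem pos_of_mem_interior_reference {x : Plane} (hx : x ∈ interior (triangle referenceVertices)) :
    0 < x 1 := by
  have h1 : x ∈ interior ((fun x : Plane => x 1) ⁻¹' Ici 0) :=
    interior_mono triangle_reference_subset hx
  have ho : IsOpenMap (fun x : Plane => x 1) :=
    (EuclideanSpace.proj 1 : Plane →L[ℝ] ℝ).isOpenMap fun r =>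
      ⟨EuclideanSpace.single 1 r, by simp⟩
  have h2 := ho.interior_preimage_subset_preimage_interior h1
  simpa using h2

theorem mem_interior_reference {x : Plane} (h0 : 0 < x 0) (h1 : 0 < x 1) (h2 : x 0 + x 1 < 1) :
    x ∈ interior (triangle referenceVertices) := by
  have ho : IsOpen {x : Plane | 0 < x 0 ∧ 0 < x 1 ∧ x 0 + x 1 < 1} := by
    have c : ∀ i : Fin 2, Continuous fun x : Plane => x i := fun i => by fun_prop
    exact (isOpen_lt continuous_const (c 0)).inter
      ((isOpen_lt continuous_const (c 1)).inter (isOpen_lt ((c 0).add (c 1)) continuous_const))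
  refine interior_maximal ?_ ho ⟨h0, h1, h2⟩
  rintro y ⟨g0, g1, g2⟩
  have hm : ∀ i, referenceVertices i ∈ triangle referenceVertices := fun i =>
    subset_convexHull ℝ _ (mem_range_self i)
  have hc : Convex ℝ (triangle referenceVertices) := convex_convexHull ℝ _
  have hy : y = ∑ i, ![1 - y 0 - y 1, y 0, y 1] i • referenceVertices i := by
    ext j
    fin_cases j <;> simp [Fin.sum_univ_three, referenceVertices]
  rw [hy]
  refine hc.sum_mem (fun i _ => ?_) ?_ fun i _ => hm i
  · fin_cases i <;> simp <;> linarith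
  · simp only [Fin.sum_univ_three, Matrix.cons_val]
    ring

theorem isCompact_triangle (P : Fin 3 → Plane) : IsCompact (triangle P) :=
  (finite_range P).isCompact_convexHull ℝ

theorem isBounded_interior_triangle (P : Fin 3 → Plane) :
    Bornology.IsBounded (interior (triangle P)) :=
  (isCompact_triangle P).isBounded.subset interior_subset

/-- Tietze extension. Replacing `u.val` by a globally continuous function is harmless because weak
derivatives see only the interior and the vertices belong to the closed triangle. -/
theorem exists_continuous_extension {S : Set Plane} (hS : IsCompact S) {w : Plane → ℝ}
    (hw : ContinuousOn w S) : ∃ W : Plane → ℝ, Continuous W ∧ EqOn W w S := by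
  obtain ⟨G, -, hG⟩ := ContinuousMap.exists_restrict_eq_forall_mem_of_closed
    (⟨S.domRestrict w, hw.domRestrict⟩ : C(S, ℝ)) (t := univ) (fun _ => mem_univ _) ⟨0, mem_univ _⟩
    hS.isClosed
  refine ⟨G, G.continuous, fun x hx => ?_⟩
  have := DFunLike.congr_fun hG ⟨x, hx⟩
  exact this

theorem H2Function.integral_trace_reference (u : H2Function (interior (triangle referenceVertices)))
    (hu : ContinuousOn u.val (triangle referenceVertices)) {T : Plane → ℝ}
    (hT : HasTrace (interior (triangle referenceVertices)) !₂[0, 0] !₂[1, 0]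
      (fun x => u.grad x 0) (fun j x => u.hess x (0, j)) T) :
    ∫ t in (0 : ℝ)..1, T !₂[t, 0] = u.val !₂[1, 0] - u.val !₂[0, 0] := by
  obtain ⟨W, hW, hWu⟩ := exists_continuous_extension (isCompact_triangle _) hu
  have hm : ∀ i, referenceVertices i ∈ triangle referenceVertices := fun i =>
    subset_convexHull ℝ _ (mem_range_self i)
  have e0 : W !₂[0, 0] = u.val !₂[0, 0] := hWu (hm 0)
  have e1 : W !₂[1, 0] = u.val !₂[1, 0] := hWu (hm 1)
  rw [← e0, ← e1]
  refine hT.integral_eq_sub_of_continuous isOpen_interior (isBounded_interior_triangle _)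
    (fun x => pos_of_mem_interior_reference) (fun x => mem_interior_reference) hW
    (memLp_plane_apply u.memLp_grad 0) (memLp_plane_apply u.memLp_hess (0, 1)) ?_
  intro φ h1 h2 h3
  rw [← u.weak_grad 0 φ h1 h2 h3]
  refine setIntegral_congr_fun isOpen_interior.measurableSet fun x hx => ?_
  rw [hWu (interior_subset hx)]

/-! ### Scalar inequalities for the bound `s` on the singular values -/

/-- Here `a = |α|`, `d = 1 - e`, and the inequality is the characteristic polynomial condition
required in `C₁_vertices_le`. For `e = 0` the largest singular value is `a / 2 + √(1 + a² / 4)`, and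
`s` is its quadratic Taylor polynomial. -/
theorem contraction_factor_lower {a e : ℝ} (ha : 0 ≤ a) (ha' : a ≤ 1/2)
    (he : 0 ≤ e) (he' : e ≤ 1/2) :
    a^2 * (1 + a*(1-e)/2 + a^2/8)^2 ≤
      ((1 + a*(1-e)/2 + a^2/8)^2 - 1) * ((1 + a*(1-e)/2 + a^2/8)^2 - (1-e)^2) := by
  have h1 : 0 ≤ (1-2*a) := by linarith
  have h2 : 0 ≤ (1-2*e) := by linarith
  have key : 0 ≤ (2-3*e+e^2) - a*(1+e/2-e^2+e^3/4) - a^2*(3/4-9/8*e+3/8*e^2)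
     - a^3*(15/32-31/64*e+e^2/4-e^3/16) - a^4*(5/32) - a^5*(3/64) - a^6/256 := by
    have t2 : a^2*(3/4-9/8*e+3/8*e^2) ≤ a*(1/2)*(3/4-9/8*e+3/8*e^2) := by
      have : 0 ≤ 3/4-9/8*e+3/8*e^2 := by nlinarith
      nlinarith [mul_nonneg (mul_nonneg ha h1) this]
    have t3 : a^3*(15/32-31/64*e+e^2/4-e^3/16) ≤ a*(1/4)*(15/32 - 31/64*e+e^2/4) := by
      have e1 : a^3 ≤ a*(1/4) := by nlinarith [mul_nonneg ha h1, mul_nonneg ha ha]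
      have e2 : 0 ≤ 15/32 - 31/64*e+e^2/4 := by nlinarith
      have e3 : 0 ≤ a^3*e^3 := by positivity
      nlinarith [mul_le_mul_of_nonneg_right e1 e2]
    have t4 : a^4 ≤ a*(1/8) := by
      have : a^3 ≤ (1/2)^3 := by gcongr
      nlinarith [mul_le_mul_of_nonneg_left this ha]
    have t5 : a^5 ≤ a*(1/16) := by
      have : a^4 ≤ (1/2)^4 := by gcongr
      nlinarith [mul_le_mul_of_nonneg_left this ha]
    have t6 : a^6 ≤ a*(1/32) := by
      have : a^5 ≤ (1/2)^5 := by gcongr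
      nlinarith [mul_le_mul_of_nonneg_left this ha]
    have b : (1+e/2-e^2+e^3/4) + (1/2)*(3/4-9/8*e+3/8*e^2) + (1/4)*(15/32 - 31/64*e+e^2/4) +
        5/32/8+3/64/16+1/256/32
       ≤ 2*(2-3*e+e^2) := by nlinarith [mul_nonneg he h2, mul_nonneg (mul_nonneg he he) h2, sq_nonneg e]
    have c : 0 ≤ (1+e/2-e^2+e^3/4) + (1/2)*(3/4-9/8*e+3/8*e^2) + (1/4)*(15/32 - 31/64*e+e^2/4) +
        5/32/8+3/64/16+1/256/32 := by
      have : 0 ≤ e^3 := by positivity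
      nlinarith
    nlinarith [mul_le_mul ha' b c (by norm_num)]
  -- The difference of the two sides is exactly `a * e` times the polynomial in `key` plus the
  -- nonnegative remainder `r`.
  have k2 := mul_nonneg (mul_nonneg ha he) key
  have r : 0 ≤ a^5/32 + a^6/64+a^7/256+a^8/4096 + 3/16*a^5*e^2*(1-e/3)+3/128*a^6*e^2 := by
    have : 0 ≤ 1 - e/3 := by linarith
    positivity
  linarith [k2, r]

/-- The slope `(1 - e) / 2` in `s` makes the terms linear in `a` agree on both sides, so the surplus
is `a²` times `key` plus terms collected in `r`. At `a = 0` the surplus is `e² (1 - 2e)`, which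
needs `e ≤ 1/2`. -/
theorem contraction_factor_upper {a e : ℝ} (ha : 0 ≤ a) (ha' : a ≤ 1/2)
    (he : 0 ≤ e) (he' : e ≤ 1/2) :
    (1 + a*(1-e)/2 + a^2/8)^3 ≤ (1-e) * (1 + 3/2*a + e + 3/2*a^2 + 2*e^2) := by
  have h1 : 0 ≤ (1-2*a) := by linarith
  have h2 : 0 ≤ (1-2*e) := by linarith
  have hs : a*(1-e)/2 + a^2/8 ≤ 9/32 := by nlinarith [mul_nonneg ha he]
  have hs0 : 0 ≤ a*(1-e)/2 + a^2/8 := by nlinarith [mul_nonneg ha he]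
  have key : 0 ≤ (3/8 - 3/4*e^2) - a*(1/2-3/4*e+3/8*e^2) - a^2*(9/64-3/16*e+3/32*e^2) - a^3*(3/128) - a^4/512 := by
    have t3 : a^3 ≤ 1/8 := by
      have : a^3 ≤ (1/2)^3 := by gcongr
      linarith
    have t4 : a^4 ≤ 1/16 := by
      have : a^4 ≤ (1/2)^4 := by gcongr
      linarith
    have t2 : a^2*(9/64-3/16*e+3/32*e^2) ≤ (1/2)^2*(9/64-3/16*e+3/32*e^2) := by
      have : 0 ≤ 9/64-3/16*e+3/32*e^2 := by nlinarith
      gcongr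
    have t1 : a*(1/2-3/4*e+3/8*e^2) ≤ 1/2*(1/2-3/4*e+3/8*e^2) := by
      have : 0 ≤ 1/2-3/4*e+3/8*e^2 := by nlinarith
      gcongr
    nlinarith [mul_nonneg he h2]
  have r : 0 ≤ e^2*(1-2*e) + a^3*e^3/8 + a^5*e*3/128 := by positivity
  nlinarith [mul_nonneg (mul_nonneg ha ha) key, r]

/-- Here `d = 1 + e` and the shear is `|α| = a (1 + e)`; the parameter `a = |α| / d` keeps
everything polynomial. -/
theorem expansion_factor_lower {a e : ℝ} (ha : 0 ≤ a) (ha' : a ≤ 1/2)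
    (he : 0 ≤ e) (he' : e ≤ 1/2) :
    (a*(1+e))^2 * (1 + e + a/2 + (a*(1+e))^2/8)^2 ≤
      ((1 + e + a/2 + (a*(1+e))^2/8)^2 - 1) * ((1 + e + a/2 + (a*(1+e))^2/8)^2 - (1+e)^2) := by
  have h1 : 0 ≤ (1-2*a) := by linarith
  have h2 : 0 ≤ (1-2*e) := by linarith
  have key : 0 ≤ (2+3*e+e^2) - a*(1+3*e+7/4*e^2) - a^2*(1/4) - a^3*(7/32+35/64*e+5/8*e^2+3/32*e^3) := by
    have t2 : a^2 ≤ (1/2)^2 := by gcongr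
    have t3 : a^3*(7/32+35/64*e+5/8*e^2+3/32*e^3) ≤ (1/2)^3*(7/32+35/64*e+5/8*e^2+3/32*e^3) := by gcongr
    have t1 : a*(1+3*e+7/4*e^2) ≤ 1/2*(1+3*e+7/4*e^2) := by gcongr
    have t4 : e^3 ≤ (1/2)^3 := by gcongr
    nlinarith
  have r : 0 ≤ 1/4*a^2*e^4 +1/4*a^2*e^5 +5/8*a^3*e^2 +3/2*a^3*e^3 +5/8*a^3*e^4 +
      7/32*a^4*e^5 +5/64*a^4*e^6 +1/32*a^5 +
      3/32*a^5*e + 1/4*a^5*e^2 + 7/16*a^5*e^3 + 11/32*a^5*e^4 + 3/32*a^5*e^5 +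
      a^6/64*(1 + 7/2*e + 9/2*e^2 + 7/2*e^3 + 4*e^4 + 9/2*e^5 + 5/2*e^6 + 1/2*e^7) +
      a^7*(1+e)^6/256 + a^8*(1+e)^8/4096 := by
    positivity
  nlinarith [mul_nonneg (mul_nonneg ha he) key, r]

/-- Equality holds at `a = 0`, and the terms linear in `a` agree as well, so only the coefficient of
`a²` and higher ones have to be compared. -/
theorem expansion_factor_upper {a e : ℝ} (ha : 0 ≤ a) (ha' : a ≤ 1/2)
    (he : 0 ≤ e) (he' : e ≤ 1/2) :
    (1 + e + a/2 + (a*(1+e))^2/8)^3 ≤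
      (1+e) * (1 + 3/2*(a*(1+e)) + 2*e + 3/2*(a*(1+e))^2 + e^2) := by
  have h2 : 0 ≤ (1-2*e) := by linarith
  have key : 0 ≤ (3/8+9/4*e+9/4*e^2-3/8*e^4) - a*(1/2+9/8*e+9/8*e^2+3/8*e^3)
     - a^2*(9/64+27/64*e+9/16*e^2+15/32*e^3+15/64*e^4+3/64*e^5) - a^3*(1+e)^4*(3/128) - a^4*(1+e)^6/512 := by
    have t1 : a*(1/2+9/8*e+9/8*e^2+3/8*e^3) ≤ 1/2*(1/2+9/8*e+9/8*e^2+3/8*e^3) := by gcongr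
    have t2 : a^2*(9/64+27/64*e+9/16*e^2+15/32*e^3+15/64*e^4+3/64*e^5) ≤ (1/2)^2*(9/64+27/64*e+9/16*e^2+15/32*e^3+15/64*e^4+3/64*e^5) := by gcongr
    have t3 : a^3*(1+e)^4 ≤ (1/2)^3*(1+e)^4 := by gcongr
    have t4 : a^4*(1+e)^6 ≤ (1/2)^4*(1+e)^6 := by gcongr
    have q2 : e^2 ≤ e/2 := by nlinarith
    have q3 : e^3 ≤ e/4 := by nlinarith
    have q4 : e^4 ≤ e/8 := by nlinarith
    have q5 : e^5 ≤ e/16 := by nlinarith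
    have q6 : e^6 ≤ e/32 := by nlinarith
    have : 0 ≤ e^3 := by positivity
    have : 0 ≤ e^4 := by positivity
    nlinarith
  nlinarith [mul_nonneg (mul_nonneg ha ha) key]

/-! ### Affine invariance of the kernel space -/

/-- The vertices of a nondegenerate triangle. -/
def Nondegenerate (P : Fin 3 → Plane) : Prop :=
  ∀ i, (P (i + 1) - P i) 0 * (P (i + 2) - P i) 1 - (P (i + 1) - P i) 1 * (P (i + 2) - P i) 0 ≠ 0

theorem Nondegenerate.ne {P : Fin 3 → Plane} (hP : Nondegenerate P) (i : Fin 3) :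
    P i ≠ P (i + 1) := fun h => hP i (by simp [h])

theorem H2Function.pullback_val (L : Plane ≃L[ℝ] Plane) (c : Plane) {U V : Set Plane}
    (hU : U = affineHomeo L c ⁻¹' V) (u : H2Function V) (x : Plane) :
    (u.pullback L c hU).val x = u.val (affineHomeo L c x) := rfl

/-- The integral of the tangential derivative along an edge vanishes if the vertex values do. -/
theorem integral_tangential_trace_eq_zero {P : Fin 3 → Plane} (hP : Nondegenerate P)
    {u : H2Function (interior (triangle P))} (hu : ContinuousOn u.val (triangle P))
    (h0 : ∀ i, u.val (P i) = 0) (i : Fin 3) {T : Plane → Plane}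
    (hT : ∀ k, HasTrace (interior (triangle P)) (P i) (P (i + 1)) (fun x => u.grad x k)
      (fun j x => u.hess x (k, j)) (fun x => T x k)) :
    ∫ t in (0 : ℝ)..1,
      ∑ j, (P (i + 1) - P i) j * T (AffineMap.lineMap (P i) (P (i + 1)) t) j = 0 := by
  -- The columns are the edge vectors leaving `P i`, so the horizontal reference edge goes to the
  -- edge in question and the vertices are relabelled cyclically.
  set L := columnEquiv _ _ (hP i) with hL
  set f := affineHomeo L (P i) with hf
  have hf0 : f !₂[0, 0] = P i := by simp [hf, hL]
  have hf1 : f !₂[1, 0] = P (i + 1) := by simp [hf, hL]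
  have hf2 : f !₂[0, 1] = P (i + 2) := by simp [hf, hL]
  have hQ : ∀ j, f (referenceVertices j) = P (i + j) := fun j => by
    fin_cases j
    · simpa [referenceVertices] using hf0
    · exact hf1
    · exact hf2
  have hr : triangle (fun j => P (i + j)) = triangle P := by
    rw [triangle, triangle]
    congr 1
    exact (Equiv.addLeft i).surjective.range_comp P
  have hU : interior (triangle referenceVertices) = f ⁻¹' interior (triangle P) := by
    rw [← hr]
    exact preimage_interior_triangle L (P i) hQ
  have hc : ContinuousOn (u.pullback L (P i) hU).val (triangle referenceVertices) := by
    refine hu.comp f.continuous.continuousOn ?_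
    rw [← hr, preimage_triangle L (P i) hQ]
    exact mapsTo_preimage _ _
  rw [← hf0, ← hf1] at hT
  have hT' := hasTrace_pullback_grad L (P i) hU u reference_ne hT 0
  have h := H2Function.integral_trace_reference _ hc hT'
  rw [H2Function.pullback_val, H2Function.pullback_val, ← hf, hf0, hf1, h0, h0, sub_zero] at h
  refine Eq.trans (intervalIntegral.integral_congr fun t _ => ?_) h
  simp only
  have e := affineHomeo_lineMap L (P i) !₂[0, 0] !₂[1, 0] t
  rw [lineMap_reference, ← hf, hf0, hf1] at e
  rw [e]
  refine Finset.sum_congr rfl fun j _ => ?_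
  congr 1
  simp [coeff, hL]

theorem integral_inner_unitNormal {p q : Plane} (hpq : p ≠ q) {T : Plane → Plane}
    (hT : ∀ j, MemLp (fun x => T x j) 2 (segmentMeasure p q)) :
    ∫ x, inner ℝ (T x) (unitNormal p q) ∂segmentMeasure p q =
      (q 1 - p 1) * (∫ t in (0 : ℝ)..1, T (AffineMap.lineMap p q t) 0) +
      (p 0 - q 0) * ∫ t in (0 : ℝ)..1, T (AffineMap.lineMap p q t) 1 := by
  have hd : dist p q ≠ 0 := dist_ne_zero.2 hpq
  have hi := fun j => memLp_segmentMeasure_comp hpq (hT j)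
  rw [integral_segmentMeasure hpq, ← intervalIntegral.integral_const_mul,
    ← intervalIntegral.integral_const_mul, ← intervalIntegral.integral_const_mul,
    ← intervalIntegral.integral_add ((hi 0).const_mul _) ((hi 1).const_mul _)]
  refine intervalIntegral.integral_congr fun t _ => ?_
  simp only [PiLp.inner_apply, Fin.sum_univ_two, unitNormal, PiLp.smul_apply, smul_eq_mul,
    RCLike.inner_apply, conj_trivial, Matrix.cons_val_zero, Matrix.cons_val_one]
  field_simp

/-- The mean of the gradient on the edge is orthogonal to the tangent (vertex values) and to the
normal (hypothesis), hence zero. -/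
theorem integral_trace_eq_zero {P : Fin 3 → Plane} (hP : Nondegenerate P)
    {u : H2Function (interior (triangle P))} (hu : ContinuousOn u.val (triangle P))
    (h0 : ∀ i, u.val (P i) = 0) (i : Fin 3) {T : Plane → Plane}
    (hT : ∀ k, HasTrace (interior (triangle P)) (P i) (P (i + 1)) (fun x => u.grad x k)
      (fun j x => u.hess x (k, j)) (fun x => T x k))
    (hn : ∫ x, inner ℝ (T x) (unitNormal (P i) (P (i + 1))) ∂segmentMeasure (P i) (P (i + 1)) = 0)
    (j : Fin 2) :
    ∫ t in (0 : ℝ)..1, T (AffineMap.lineMap (P i) (P (i + 1)) t) j = 0 := by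
  have h1 := integral_tangential_trace_eq_zero hP hu h0 i hT
  have hi := fun j => memLp_segmentMeasure_comp (hP.ne i) (hT j).1
  rw [integral_inner_unitNormal (hP.ne i) fun j => (hT j).1] at hn
  simp_rw [Fin.sum_univ_two] at h1
  rw [intervalIntegral.integral_add ((hi 0).const_mul _) ((hi 1).const_mul _),
    intervalIntegral.integral_const_mul, intervalIntegral.integral_const_mul] at h1
  simp only [PiLp.sub_apply] at h1
  set a := ∫ t in (0 : ℝ)..1, T (AffineMap.lineMap (P i) (P (i + 1)) t) 0
  set b := ∫ t in (0 : ℝ)..1, T (AffineMap.lineMap (P i) (P (i + 1)) t) 1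
  set v := P (i + 1) 0 - P i 0 with hv
  set w := P (i + 1) 1 - P i 1 with hw
  have hvw : v ^ 2 + w ^ 2 ≠ 0 := fun h => by
    have e0 : v = 0 := by nlinarith [sq_nonneg v, sq_nonneg w]
    have e1 : w = 0 := by nlinarith [sq_nonneg v, sq_nonneg w]
    refine hP i ?_
    simp only [PiLp.sub_apply]
    rw [← hv, ← hw, e0, e1]
    ring
  have hn' : w * a - v * b = 0 := by rw [← hn, hv]; ring
  have ha : (v ^ 2 + w ^ 2) * a = 0 := by linear_combination v * h1 + w * hn'
  have hb : (v ^ 2 + w ^ 2) * b = 0 := by linear_combination w * h1 - v * hn'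
  fin_cases j
  · exact (mul_eq_zero.1 ha).resolve_left hvw
  · exact (mul_eq_zero.1 hb).resolve_left hvw

/-- The kernel space of the Fujino--Morley interpolation is invariant under affine maps. -/
theorem pullback_mem_VFM (L : Plane ≃L[ℝ] Plane) (c : Plane) {P Q : Fin 3 → Plane}
    (h : ∀ i, affineHomeo L c (P i) = Q i) (hQ : Nondegenerate Q)
    {u : H2Function (interior (triangle Q))} (hu : u ∈ VFM Q) :
    u.pullback L c (preimage_interior_triangle L c h) ∈ VFM P := by
  obtain ⟨h1, h2, h3⟩ := hu
  refine ⟨?_, fun i => ?_, fun i => ?_⟩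
  · refine h1.comp (affineHomeo L c).continuous.continuousOn ?_
    rw [preimage_triangle L c h]
    exact mapsTo_preimage _ _
  · rw [H2Function.pullback_val, h, h2]
  · obtain ⟨T, hT, hn⟩ := h3 i
    have hne : P i ≠ P (i + 1) := fun e => hQ.ne i (by rw [← h, ← h, e])
    have hz := integral_trace_eq_zero hQ h1 h2 i hT hn
    have hi := fun j => memLp_segmentMeasure_comp (hQ.ne i) (hT j).1
    have hT2 := hT
    rw [← h i, ← h (i + 1)] at hT2
    have hT' := hasTrace_pullback_grad L c (preimage_interior_triangle L c h) u hne hT2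
    refine ⟨fun x => WithLp.toLp 2 fun k => ∑ j, coeff L k j * T (affineHomeo L c x) j, hT', ?_⟩
    rw [integral_inner_unitNormal hne fun j => (hT' j).1]
    -- Each component of the pulled-back gradient has mean zero, so its normal integral vanishes
    -- whatever the direction of the new normal.
    have hz' : ∀ k, ∫ t in (0 : ℝ)..1, ∑ j, coeff L k j *
        T (affineHomeo L c (AffineMap.lineMap (P i) (P (i + 1)) t)) j = 0 := fun k => by
      simp_rw [affineHomeo_lineMap, h]
      rw [intervalIntegral.integral_finsetSum fun j _ => (hi j).const_mul _]
      simp_rw [intervalIntegral.integral_const_mul, hz, mul_zero, Finset.sum_const_zero]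
    simp only [hz', mul_zero, add_zero]

/-! ### Comparison of the constants -/

/-- Pointwise bounds integrate to bounds of the seminorms of `u ∘ f`. The constant `B'` serves only
to ensure that the pullback again has nonzero Hessian and is therefore a competitor. -/
theorem C₁_le_of_affine (L : Plane ≃L[ℝ] Plane) (c : Plane) {P Q : Fin 3 → Plane}
    (h : ∀ i, affineHomeo L c (P i) = Q i) (hQ : Nondegenerate Q) {A B B' : ℝ} (hA : 0 ≤ A)
    (hgrad : ∀ g : EuclideanSpace ℝ (Fin 2), ‖g‖ ≤
      A * ‖(WithLp.toLp 2 fun i => ∑ j, coeff L i j * g j : EuclideanSpace ℝ (Fin 2))‖)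
    (hhess : ∀ M : EuclideanSpace ℝ (Fin 2 × Fin 2),
      ‖(WithLp.toLp 2 fun p => ∑ k, coeff L p.1 k * ∑ l, coeff L p.2 l * M (k, l) :
        EuclideanSpace ℝ (Fin 2 × Fin 2))‖ ≤ B * ‖M‖)
    (hhess' : ∀ M : EuclideanSpace ℝ (Fin 2 × Fin 2), ‖M‖ ≤ B' *
      ‖(WithLp.toLp 2 fun p => ∑ k, coeff L p.1 k * ∑ l, coeff L p.2 l * M (k, l) :
        EuclideanSpace ℝ (Fin 2 × Fin 2))‖) :
    C₁ Q ≤ ENNReal.ofReal (A * B) * C₁ P := by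
  refine iSup₂_le fun u hu => ?_
  obtain ⟨huV, hu0⟩ := hu
  have hUV := preimage_interior_triangle L c h
  set v := u.pullback L c hUV with hv
  have hvV : v ∈ VFM P := pullback_mem_VFM L c h hQ huV
  have hsc : IsScaledImage (affineHomeo L c) (volume.restrict (interior (triangle P)))
      (volume.restrict (interior (triangle Q))) := by
    rw [hUV]
    exact isScaledImage_volume_restrict L c _
  obtain ⟨κ, hκ0, hκt, hκ⟩ := hsc.exists_eLpNorm
  have eg : u.gradNorm = κ * _ := hκ _ u.grad
  have eh : u.hessNorm = κ * _ := hκ _ u.hess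
  set G := eLpNorm (u.grad ∘ affineHomeo L c) 2 (volume.restrict (interior (triangle P)))
  set H := eLpNorm (u.hess ∘ affineHomeo L c) 2 (volume.restrict (interior (triangle P))) with hH
  have i1 : G ≤ ENNReal.ofReal A * v.gradNorm :=
    eLpNorm_le_mul_eLpNorm_of_ae_le_mul (ae_of_all _ fun x => hgrad _) 2
  have i2 : v.hessNorm ≤ ENNReal.ofReal B * H :=
    eLpNorm_le_mul_eLpNorm_of_ae_le_mul (ae_of_all _ fun x => hhess _) 2
  have i3 : H ≤ ENNReal.ofReal B' * v.hessNorm :=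
    eLpNorm_le_mul_eLpNorm_of_ae_le_mul (ae_of_all _ fun x => hhess' _) 2
  have hH0 : H ≠ 0 := fun e => hu0 (by rw [eh, e, mul_zero])
  have hHt : H ≠ ⊤ := (hsc.memLp_comp u.memLp_hess).2.ne
  have hv0 : v.hessNorm ≠ 0 := fun e => hH0 (by simpa [e] using i3)
  have hvt : v.hessNorm ≠ ⊤ := v.memLp_hess.2.ne
  rw [eg, eh, ENNReal.mul_div_mul_left _ _ hκ0 hκt, ENNReal.div_le_iff hH0 hHt]
  calc G ≤ ENNReal.ofReal A * v.gradNorm := i1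
    _ = ENNReal.ofReal A * (v.gradNorm / v.hessNorm * v.hessNorm) := by
      rw [ENNReal.div_mul_cancel hv0 hvt]
    _ ≤ ENNReal.ofReal A * (C₁ P * (ENNReal.ofReal B * H)) := by
      gcongr
      exact le_iSup₂ (f := fun (w : H2Function (interior (triangle P)))
        (_ : w ∈ {w | w ∈ VFM P ∧ w.hessNorm ≠ 0}) => w.gradNorm / w.hessNorm) v ⟨hvV, hv0⟩
    _ = ENNReal.ofReal (A * B) * C₁ P * H := by
      rw [ENNReal.ofReal_mul hA]
      ring

theorem nondegenerate_vertices {a b : ℝ} (hb : 0 < b) : Nondegenerate (vertices a b) := by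
  intro i
  fin_cases i <;> simp [vertices] <;> first | exact hb.ne' | nlinarith

theorem quadratic_form_nonneg {a b c : ℝ} (ha : 0 ≤ a) (hc : 0 ≤ c) (h : b ^ 2 ≤ a * c)
    (x y : ℝ) : 0 ≤ a * x ^ 2 + 2 * b * x * y + c * y ^ 2 := by
  rcases ha.eq_or_lt with rfl | ha
  · have : b = 0 := by nlinarith [sq_nonneg b]
    subst this
    nlinarith [mul_nonneg hc (sq_nonneg y)]
  · have h1 : 0 ≤ a * (a * x ^ 2 + 2 * b * x * y + c * y ^ 2) := by
      nlinarith [sq_nonneg (a * x + b * y), mul_nonneg (sub_nonneg.2 h) (sq_nonneg y)]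
    exact nonneg_of_mul_nonneg_right h1 ha

/-- Hypothesis `h` says that the characteristic polynomial of `L Lᵀ`, of trace `1 + α² + d²` and
determinant `d²`, is nonnegative at `s²`. With `1 ≤ s` and `d ≤ s` this places `s` at or above the
largest singular value. -/
theorem C₁_vertices_le {a b α d s : ℝ} (hb : 0 < b) (hd : 0 < d) (hs1 : 1 ≤ s) (hsd : d ≤ s)
    (h : α ^ 2 * s ^ 2 ≤ (s ^ 2 - 1) * (s ^ 2 - d ^ 2)) :
    C₁ (vertices (a + α * b) (d * b)) ≤ ENNReal.ofReal (s / d * s ^ 2) * C₁ (vertices a b) := by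
  have hs0 : 0 < s := by linarith
  have k1 : 0 ≤ s ^ 2 - 1 := by nlinarith
  have k2 : 0 ≤ s ^ 2 - d ^ 2 := by nlinarith
  have k3 : 0 ≤ s ^ 2 - 1 - α ^ 2 := by
    rcases k2.eq_or_lt with e | e
    · have : α ^ 2 * s ^ 2 ≤ 0 := by rw [← e] at h; linarith
      nlinarith [sq_nonneg α]
    · by_contra! hc
      nlinarith [mul_lt_mul_of_pos_right hc e, mul_nonneg (sq_nonneg α) (sq_nonneg d)]
  have k4 : 0 ≤ s ^ 2 - d ^ 2 - α ^ 2 := by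
    rcases k1.eq_or_lt with e | e
    · have : α ^ 2 * s ^ 2 ≤ 0 := by rw [← e] at h; linarith
      nlinarith [sq_nonneg α]
    · by_contra! hc
      nlinarith [mul_lt_mul_of_pos_right hc e, sq_nonneg α]
  have q1 : ∀ x y : ℝ, x ^ 2 + (α * x + d * y) ^ 2 ≤ s ^ 2 * (x ^ 2 + y ^ 2) := fun x y => by
    have := quadratic_form_nonneg (b := -(α * d)) k3 k2 (by nlinarith) x y
    nlinarith
  -- In the variables `x` and `α x + d y` this form has determinant condition equal to `h`.
  have q2 : ∀ x y : ℝ, d ^ 2 * (x ^ 2 + y ^ 2) ≤ s ^ 2 * (x ^ 2 + (α * x + d * y) ^ 2) :=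
    fun x y => by
      have := quadratic_form_nonneg (b := α) k4 k1 (by nlinarith) x (α * x + d * y)
      nlinarith
  have hdet : (!₂[1, 0] : Plane) 0 * (!₂[α, d] : Plane) 1 -
      (!₂[1, 0] : Plane) 1 * (!₂[α, d] : Plane) 0 ≠ 0 := by simpa using hd.ne'
  set L := columnEquiv !₂[1, 0] !₂[α, d] hdet with hL
  have c00 : coeff L 0 0 = 1 := by simp [coeff, hL]
  have c01 : coeff L 0 1 = 0 := by simp [coeff, hL]
  have c10 : coeff L 1 0 = α := by simp [coeff, hL]
  have c11 : coeff L 1 1 = d := by simp [coeff, hL]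
  have hsq : ∀ {x y : ℝ}, 0 ≤ x → 0 ≤ y → x ^ 2 ≤ y ^ 2 → x ≤ y := fun hx hy hxy =>
    (pow_le_pow_iff_left₀ hx hy two_ne_zero).1 hxy
  refine C₁_le_of_affine L 0 (B' := (s / d) ^ 2) (fun i => ?_)
    (nondegenerate_vertices (mul_pos hd hb)) (by positivity)
    (fun g => hsq (norm_nonneg _) (by positivity) ?_)
    (fun M => hsq (norm_nonneg _) (by positivity) ?_)
    (fun M => hsq (norm_nonneg _) (by positivity) ?_)
  · ext j
    fin_cases i <;> fin_cases j <;> simp [vertices, hL] <;> ring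
  · rw [mul_pow, div_pow, div_mul_eq_mul_div, le_div_iff₀ (by positivity), mul_comm]
    simp only [EuclideanSpace.norm_sq_eq, Real.norm_eq_abs, sq_abs, Fin.sum_univ_two, c00, c01, c10,
      c11]
    have := q2 (g 0) (g 1)
    nlinarith
  · rw [mul_pow]
    simp only [EuclideanSpace.norm_sq_eq, Real.norm_eq_abs, sq_abs, Fintype.sum_prod_type,
      Fin.sum_univ_two, c00, c01, c10, c11]
    -- The Hessian transforms as `Lᵀ M L`; the bound for one factor is applied to the rows of `M`
    -- and then to the columns of the result, which gives `s²`.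
    have e1 := q1 (M (0, 0)) (M (0, 1))
    have e2 := q1 (M (1, 0)) (M (1, 1))
    have e3 := q1 (M (0, 0)) (M (1, 0))
    have e4 := q1 (α * M (0, 0) + d * M (0, 1)) (α * M (1, 0) + d * M (1, 1))
    have e5 := mul_le_mul_of_nonneg_left (add_le_add e1 e2) (sq_nonneg s)
    linarith
  · rw [mul_pow, div_pow, div_pow, div_mul_eq_mul_div, le_div_iff₀ (by positivity), mul_comm]
    simp only [EuclideanSpace.norm_sq_eq, Real.norm_eq_abs, sq_abs, Fintype.sum_prod_type,
      Fin.sum_univ_two, c00, c01, c10, c11]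
    have e1 := q2 (M (0, 0)) (M (0, 1))
    have e2 := q2 (M (1, 0)) (M (1, 1))
    have e3 := q2 (M (0, 0)) (M (1, 0))
    have e4 := q2 (α * M (0, 0) + d * M (0, 1)) (α * M (1, 0) + d * M (1, 1))
    have e5 := mul_le_mul_of_nonneg_left (add_le_add e1 e2) (sq_nonneg d)
    have e6 := mul_le_mul_of_nonneg_left (add_le_add e3 e4) (sq_nonneg s)
    linarith

end FujinoMorley

end

theorem mainTheorem3 (a b α ε : ℝ)
    (hB : (a, b) ∈ FujinoMorley.Ω)
    (hB' : (a + α * b, (1 + ε) * b) ∈ FujinoMorley.Ω)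
    (hα : |α| ≤ 1 / 2) (hε : |ε| ≤ 1 / 2) :
    (0 ≤ ε →
      FujinoMorley.C₁ (FujinoMorley.vertices (a + α * b) ((1 + ε) * b)) ≤
        ENNReal.ofReal (1 + 3 / 2 * |α| + 2 * |ε| + 3 / 2 * |α| ^ 2 + |ε| ^ 2) *
          FujinoMorley.C₁ (FujinoMorley.vertices a b)) ∧
    (ε ≤ 0 →
      FujinoMorley.C₁ (FujinoMorley.vertices (a + α * b) ((1 + ε) * b)) ≤
        ENNReal.ofReal (1 + 3 / 2 * |α| + |ε| + 3 / 2 * |α| ^ 2 + 2 * |ε| ^ 2) *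
          FujinoMorley.C₁ (FujinoMorley.vertices a b)) := by
  obtain ⟨hα0, hε'⟩ := And.intro (abs_nonneg α) (abs_nonneg ε)
  have hb : 0 < b := hB.2.2
  constructor
  · intro h0
    rw [abs_of_nonneg h0] at hε hε' ⊢
    have hd : 0 < 1 + ε := by linarith
    -- In terms of `α` the bound is `s = d + |α| / (2d) + α² / 8`, so that `s³ / d` has the linear
    -- term `3/2 |α|`.
    set β := |α| / (1 + ε) with hβ
    have hβα : β * (1 + ε) = |α| := div_mul_cancel₀ _ hd.ne'
    have hβ0 : 0 ≤ β := by positivity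
    have hβ1 : β ≤ 1 / 2 := by rw [hβ, div_le_iff₀ hd]; linarith
    have h1 := FujinoMorley.expansion_factor_lower hβ0 hβ1 h0 hε
    have h2 := FujinoMorley.expansion_factor_upper hβ0 hβ1 h0 hε
    rw [hβα] at h1 h2
    set s := 1 + ε + β / 2 + |α| ^ 2 / 8 with hs
    have hsd : 1 + ε ≤ s := by rw [hs]; linarith [sq_nonneg |α|]
    rw [sq_abs] at h1
    refine (FujinoMorley.C₁_vertices_le hb hd (by linarith) hsd h1).trans ?_
    gcongr
    rw [div_mul_eq_mul_div, div_le_iff₀ hd]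
    linarith
  · intro h0
    obtain ⟨e, rfl⟩ : ∃ e, ε = -e := ⟨-ε, (neg_neg ε).symm⟩
    have he : 0 ≤ e := by linarith
    rw [abs_neg, abs_of_nonneg he] at hε hε' ⊢
    have hd : 0 < 1 + -e := by linarith
    have h1 := FujinoMorley.contraction_factor_lower hα0 hα he hε
    have h2 := FujinoMorley.contraction_factor_upper hα0 hα he hε
    have hp : 0 ≤ |α| * (1 - e) := mul_nonneg hα0 (by linarith)
    set s := 1 + |α| * (1 - e) / 2 + |α| ^ 2 / 8 with hs
    have hs1 : 1 ≤ s := by rw [hs]; linarith [sq_nonneg |α|]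
    rw [sq_abs, sub_eq_add_neg 1 e] at h1
    refine (FujinoMorley.C₁_vertices_le hb hd hs1 (by linarith) h1).trans ?_
    gcongr
    rw [div_mul_eq_mul_div, div_le_iff₀ hd]
    linarith
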